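/- Let $Y$ be a finite nonempty connected graph with vertex set $VY$ and set of geometric (unoriented) edges $EY$, where loops and multiple edges are allowed. Let $(\mathcal G, Y)$ be a graph of groups on $Y$: groups $G_u$ for $u\in VY$ and $G_e$ for $e\in EY$, together with, for each edge $e$ with a chosen orientation from $\partial_0 e$ to $\partial_1 e$, monomorphisms $\alpha_e : G_e\to G_{\partial_0 e}$ and $\beta_e: G_e\to G_{\partial_1 e}$. Let $T$ be a maximal subtree of $Y$ and let $G=\pi_1(\mathcal G,Y,T)$ be the fundamental group of $(\mathcal G,Y)$, that is, the quotient of the free product of all the groups $G_u$ and of the free group on $\{t_e : e\in EY\}$ by the relations $t_e\,\beta_e(a)\,t_e^{-1}=\alpha_e(a)$ for $e\in EY$, $a\in G_e$, and $t_e=1$ for every edge $e$ of $T$. Assume that every vertex group $G_u$ is finitely generated, that every edge group $G_e$ is finite, and that each vertex group is either residually finite or virtually torsion free (some of them may be the one, some the other). For a finitely generated group $\Gamma$, let $r(\Gamma)$ be the minimal number of generators of $\Gamma$ and let $$\mathrm{RG}(\Gamma)=\inf_{H}\frac{r(H)-1}{[\Gamma:H]}$$ be its rank gradient, where $H$ ranges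 over all subgroups of finite index in $\Gamma$. Then (note that $G$ is finitely generated, so that $\mathrm{RG}(G)$ is defined) $$\mathrm{RG}(G)=\sum_{u\in VY}\mathrm{RG}(G_u)+\sum_{e\in EY}\frac1{|G_e|}.$$ -/

import Mathlib

/-- A graph of groups with vertex set `V` and set of geometric edges `E`. Loops and multiple edges
are allowed. Every geometric edge carries a fixed orientation, from `origin e` to `terminus e`;
its edge group is embedded in the vertex groups of both endpoints. Connectedness of the underlying
graph is part of `GraphOfGroups.IsMaximalTree` below. -/
structure GraphOfGroups (V E : Type*) where
  /-- The initial vertex of an edge. -/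
  origin : E → V
  /-- The terminal vertex of an edge. -/
  terminus : E → V
  /-- The vertex groups. -/
  vertexGroup : V → Type*
  [vertexGroupInst : ∀ u, Group (vertexGroup u)]
  /-- The edge groups. -/
  edgeGroup : E → Type*
  [edgeGroupInst : ∀ e, Group (edgeGroup e)]
  /-- The monomorphism from an edge group to the vertex group at the origin. -/
  toOrigin : ∀ e, edgeGroup e →* vertexGroup (origin e)
  toOrigin_injective : ∀ e, Function.Injective (toOrigin e)
  /-- The monomorphism from an edge group to the vertex group at the terminus. -/
  toTerminus : ∀ e, edgeGroup e →* vertexGroup (terminus e)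
  toTerminus_injective : ∀ e, Function.Injective (toTerminus e)

namespace GraphOfGroups

attribute [instance] GraphOfGroups.vertexGroupInst GraphOfGroups.edgeGroupInst

/-- The edge set `T` is the edge set of a maximal (that is, spanning) subtree of the underlying
graph: no edge of `T` is a loop, no two edges of `T` are parallel, and the simple graph on the whole
vertex set whose edges are those of `T` is a tree, that is, nonempty, connected and without cycles.
Such a `T` exists if and only if the underlying graph is nonempty and connected. -/
structure IsMaximalTree {V E : Type*} (𝒢 : GraphOfGroups V E) (T : Set E) : Prop where
  not_loop : ∀ e ∈ T, 𝒢.origin e ≠ 𝒢.terminus e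
  not_parallel : Set.InjOn (fun e => s(𝒢.origin e, 𝒢.terminus e)) T
  isTree : (SimpleGraph.fromEdgeSet ((fun e => s(𝒢.origin e, 𝒢.terminus e)) '' T)).IsTree

/-- The free product of all the vertex groups and of the free group on the set of edges. -/
abbrev FreeProd {V E : Type*} (𝒢 : GraphOfGroups V E) :=
  Monoid.Coprod (Monoid.CoprodI 𝒢.vertexGroup) (FreeGroup E)

/-- The inclusion of a vertex group in the free product. -/
def vertexIncl {V E : Type*} (𝒢 : GraphOfGroups V E) (u : V) : 𝒢.vertexGroup u →* 𝒢.FreeProd :=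
  Monoid.Coprod.inl.comp Monoid.CoprodI.of

/-- The stable letter of an edge in the free product. -/
def stableLetter {V E : Type*} (𝒢 : GraphOfGroups V E) (e : E) : 𝒢.FreeProd :=
  Monoid.Coprod.inr (FreeGroup.of e)

/-- The relators of the fundamental group of the graph of groups relative to `T`: for an edge `e`
with stable letter `t` and an element `a` of its edge group, `t * (a at the terminus) * t⁻¹` is
identified with `a` at the origin, and `t` is trivial if `e` is an edge of `T`. -/
def relators {V E : Type*} (𝒢 : GraphOfGroups V E) (T : Set E) : Set 𝒢.FreeProd :=
  {x | ∃ (e : E) (a : 𝒢.edgeGroup e),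
      x = 𝒢.stableLetter e * 𝒢.vertexIncl (𝒢.terminus e) (𝒢.toTerminus e a) *
        (𝒢.stableLetter e)⁻¹ * (𝒢.vertexIncl (𝒢.origin e) (𝒢.toOrigin e a))⁻¹} ∪
    𝒢.stableLetter '' T

/-- The fundamental group `π₁(𝒢, Y, T)` of a graph of groups relative to a maximal tree `T`. -/
abbrev FundamentalGroup {V E : Type*} (𝒢 : GraphOfGroups V E) (T : Set E) :=
  𝒢.FreeProd ⧸ Subgroup.normalClosure (𝒢.relators T)

/-- The fundamental group of a finite graph of finitely generated groups is finitely generated. -/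
instance fundamentalGroup_fg {V E : Type*} [Finite V] [Finite E] (𝒢 : GraphOfGroups V E)
    [∀ u, Group.FG (𝒢.vertexGroup u)] (T : Set E) : Group.FG (𝒢.FundamentalGroup T) := by
  have h1 : Monoid.FG (Monoid.CoprodI 𝒢.vertexGroup) := by
    constructor
    rw [← Monoid.CoprodI.iSup_mrange_of]
    refine Submonoid.FG.iSup _ fun u => ?_
    exact (Monoid.fg_iff_submonoid_fg _).1 (Monoid.fg_range _)
  have h2 : Group.FG 𝒢.FreeProd := by
    rw [Group.fg_iff_monoid_fg]
    constructor
    rw [← Monoid.Coprod.mrange_inl_sup_mrange_inr]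
    exact Submonoid.FG.sup ((Monoid.fg_iff_submonoid_fg _).1 (Monoid.fg_range _))
      ((Monoid.fg_iff_submonoid_fg _).1 (Monoid.fg_range _))
  infer_instance

end GraphOfGroups

/-- A group is virtually torsion free if it has a subgroup of finite index in which the identity is
the only element of finite order. -/
def IsVirtuallyTorsionFree (G : Type*) [Group G] : Prop :=
  ∃ H : Subgroup G, H.FiniteIndex ∧ ∀ h ∈ H, IsOfFinOrder h → h = 1

/-- The rank gradient of a finitely generated group `G`: the infimum, over all subgroups `H` of
finite index, of `(r(H) - 1) / [G : H]`, where `r(H)` is the minimal number of generators of `H`.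
The family is nonempty (take `H = G`) and bounded below by `-1`, so this is a genuine infimum. -/
noncomputable def rankGradient (G : Type*) [Group G] [Group.FG G] : ℝ :=
  ⨅ H : {H : Subgroup G // H.FiniteIndex},
    haveI := H.2
    ((Group.rank (H : Subgroup G) : ℝ) - 1) / ((H : Subgroup G).index : ℝ)

/-! Let $H\le G$ have finite index and suppose that its conjugates meet the edge groups trivially.
The action of $G$ on $X=G/H$ determines a covering graph of groups: its vertices are the orbits of
the $G_u$ on $X$, with point stabilizers as vertex groups, and its edges are the orbits of the
$G_e$, with trivial edge groups. So $H$ should be the free product of these stabilizers and of a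
free group of rank (edges) − (vertices) + 1. Since $G_e$ acts freely there are $|X|/|G_e|$ edges
over $e$, and Grushko's theorem gives $r(H)-1=\sum_u\sum_o(r(\mathrm{Stab}_o)-1)+\sum_e|X|/|G_e|$.
After division by $|X|=[G:H]$, the vertex $u$ contributes a weighted mean of values
$(r(K)-1)/[G_u:K]$ (`exists_rank_sub_one_div_index_eq`).

By Schreier's inequality $(r(H)-1)/[G:H]$ does not increase when $H$ shrinks. For the lower bound
$H$ may therefore be intersected with a normal subgroup that meets the edge groups trivially; each
mean is at least $\mathrm{RG}(G_u)$. For the upper bound, nearly optimal normal subgroups $K_u$ of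
the $G_u$, small enough to avoid the edge groups, are realized simultaneously as $H\cap G_u$ with
$H$ normal (`exists_normal_finiteIndex`). This works because two free actions of a finite group on
finite sets of equal size are isomorphic.

The rank formula is proved without Bass–Serre theory. For `≤`, Schreier generators of a stabilizer
are read off the covering graph with a spanning tree removed. This uses only that the vertex groups
and stable letters generate $G$ and satisfy the relations, so it applies to any `Marking`; a bouquet
of trivial groups yields Schreier's inequality. For `≥`, a cocycle on $X$ with values in the
expected free product $F$ is built from the presentation of $G$. Its values on generators of the
stabilizer, together with (vertices) − 1 further elements, generate $F$, and Grushko bounds $r(F)$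
below.

Grushko's theorem is proved by Stallings folds, in the language of systems of equations: $n$
generators of $A*B$ give a rigid system of complexity at most $n$, folding keeps both properties,
and an unfolded rigid system visibly contains generators of $A$ and of $B$. -/

/-! ### Grushko's theorem: folding systems of equations. -/

/-- A finite bipartite system of equations over two groups `A` and `B`, in unknowns indexed by `V`
and `W`: an edge `(v, a, b, w)` stands for `a • x v = b • y w`, a left loop `(v, a)` for
`a • x v = x v`, and a right loop `(w, b)` for `b • y w = y w`. -/
structure BipartiteSystem (A B V W : Type*) where
  /-- The equations between an unknown of either kind. -/
  edges : Multiset (V × A × B × W)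
  /-- The equations on an unknown of the first kind. -/
  leftLoops : Multiset (V × A)
  /-- The equations on an unknown of the second kind. -/
  rightLoops : Multiset (W × B)

namespace BipartiteSystem

universe u v

section Basic

set_option linter.unusedSectionVars false

variable {A : Type u} {B : Type v} [Group A] [Group B] {V W : Type}

/-- Solutions of a bipartite system in a set acted upon by both groups. -/
structure IsSolution (𝒮 : BipartiteSystem A B V W) {Z : Type*} (φ : A →* Equiv.Perm Z)
    (ψ : B →* Equiv.Perm Z) (x : V → Z) (y : W → Z) : Prop where
  edge : ∀ e ∈ 𝒮.edges, φ e.2.1 (x e.1) = ψ e.2.2.1 (y e.2.2.2)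
  left : ∀ s ∈ 𝒮.leftLoops, φ s.2 (x s.1) = x s.1
  right : ∀ s ∈ 𝒮.rightLoops, ψ s.2 (y s.1) = y s.1

/-- A bipartite system is rigid if all its solutions are constant, the constant value being fixed by
both groups. -/
def IsRigid (𝒮 : BipartiteSystem A B V W) : Prop :=
  ∀ (Z : Type (max u v)) (φ : A →* Equiv.Perm Z) (ψ : B →* Equiv.Perm Z) (x : V → Z) (y : W → Z),
    𝒮.IsSolution φ ψ x y →
      ∃ z, (∀ i, x i = z) ∧ (∀ j, y j = z) ∧ (∀ a, φ a z = z) ∧ ∀ b, ψ b z = z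

/-- The number of equations less the number of unknowns, plus one, is at most `n`. -/
def ComplexityLE [Fintype V] [Fintype W] (𝒮 : BipartiteSystem A B V W) (n : ℕ) : Prop :=
  𝒮.edges.card + 𝒮.leftLoops.card + 𝒮.rightLoops.card + 1 ≤ n + Fintype.card V + Fintype.card W

/-- Exchange of the two groups. -/
def swap (𝒮 : BipartiteSystem A B V W) : BipartiteSystem B A W V where
  edges := 𝒮.edges.map fun e => (e.2.2.2, e.2.2.1, e.2.1, e.1)
  leftLoops := 𝒮.rightLoops
  rightLoops := 𝒮.leftLoops

@[simp]
theorem swap_swap (𝒮 : BipartiteSystem A B V W) : 𝒮.swap.swap = 𝒮 := by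
  cases 𝒮
  simp [swap]

theorem IsSolution.swap {𝒮 : BipartiteSystem A B V W} {Z : Type*} {φ : A →* Equiv.Perm Z}
    {ψ : B →* Equiv.Perm Z} {x : V → Z} {y : W → Z} (h : 𝒮.IsSolution φ ψ x y) :
    𝒮.swap.IsSolution ψ φ y x := by
  refine ⟨fun e he => ?_, h.right, h.left⟩
  obtain ⟨f, hf, rfl⟩ := Multiset.mem_map.1 he
  exact (h.edge f hf).symm

theorem IsRigid.swap {𝒮 : BipartiteSystem A B V W} (h : 𝒮.IsRigid) : 𝒮.swap.IsRigid := by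
  intro Z φ ψ x y hs
  have hs' := hs.swap
  rw [swap_swap] at hs'
  obtain ⟨z, h1, h2, h3, h4⟩ := h Z ψ φ y x hs'
  exact ⟨z, h2, h1, h4, h3⟩

theorem ComplexityLE.swap [Fintype V] [Fintype W] {𝒮 : BipartiteSystem A B V W} {n : ℕ}
    (h : 𝒮.ComplexityLE n) : 𝒮.swap.ComplexityLE n := by
  simp only [ComplexityLE, BipartiteSystem.swap, Multiset.card_map] at h ⊢
  omega

/-- Imposing one further equation `x v' = a • x v` between unknowns of the first kind, either by a
loop or by eliminating `x v'`, raises the complexity by at most one. -/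
theorem exists_glue [Fintype V] [Fintype W] [Nonempty V] (𝒮 : BipartiteSystem A B V W)
    (v v' : V) (a : A) :
    ∃ (V' : Type) (_ : Fintype V') (_ : Nonempty V') (𝒮₁ : BipartiteSystem A B V' W) (π : V → V')
      (t : V → A), 𝒮₁.edges.card = 𝒮.edges.card ∧
      𝒮₁.leftLoops.card + Fintype.card V = 𝒮.leftLoops.card + 1 + Fintype.card V' ∧
      𝒮₁.rightLoops = 𝒮.rightLoops ∧ Function.Surjective π ∧ t v = 1 ∧
      ∀ (Z : Type (max u v)) (φ : A →* Equiv.Perm Z) (ψ : B →* Equiv.Perm Z) (x : V' → Z)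
        (y : W → Z), 𝒮₁.IsSolution φ ψ x y →
          𝒮.IsSolution φ ψ (fun i => φ (t i) (x (π i))) y ∧
            φ (t v') (x (π v')) = φ a (φ (t v) (x (π v))) := by
  classical
  by_cases hv : v = v'
  · subst hv
    refine ⟨V, ‹_›, ‹_›, ⟨𝒮.edges, (v, a) ::ₘ 𝒮.leftLoops, 𝒮.rightLoops⟩, id, 1, rfl, by simp, rfl,
      Function.surjective_id, rfl, ?_⟩
    · intro Z φ ψ x y h
      refine ⟨⟨fun e he => ?_, fun s hs => ?_, h.right⟩, ?_⟩
      · simpa using h.edge e he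
      · simpa using h.left s (Multiset.mem_cons_of_mem hs)
      · simpa using (h.left _ (Multiset.mem_cons_self _ _)).symm
  · let π : V → {i // i ≠ v'} := fun i => if h : i = v' then ⟨v, hv⟩ else ⟨i, h⟩
    let t : V → A := fun i => if i = v' then a else 1
    have hπv : π v = ⟨v, hv⟩ := dif_neg hv
    have hπv' : π v' = ⟨v, hv⟩ := dif_pos rfl
    have htv : t v = 1 := if_neg hv
    have htv' : t v' = a := if_pos rfl
    refine ⟨{i // i ≠ v'}, inferInstance, ⟨⟨v, hv⟩⟩,
      ⟨𝒮.edges.map fun e => (π e.1, e.2.1 * t e.1, e.2.2.1, e.2.2.2),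
        𝒮.leftLoops.map fun s => (π s.1, (t s.1)⁻¹ * s.2 * t s.1), 𝒮.rightLoops⟩, π, t, by simp,
      ?_, rfl, ?_, htv, ?_⟩
    · have hc : Fintype.card {i // i ≠ v'} + 1 = Fintype.card V := by
        rw [Fintype.card_subtype_compl, Fintype.card_subtype_eq]
        have := Fintype.card_pos_iff.2 ⟨v⟩
        omega
      rw [Multiset.card_map]
      omega
    · exact fun i => ⟨i, dif_neg i.2⟩
    · intro Z φ ψ x y h
      refine ⟨⟨fun e he => ?_, fun s hs => ?_, h.right⟩, ?_⟩
      · simpa using h.edge _ (Multiset.mem_map_of_mem _ he)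
      · have := h.left _ (Multiset.mem_map_of_mem _ hs)
        rwa [map_mul, map_mul, map_inv, Equiv.Perm.mul_apply, Equiv.Perm.mul_apply,
          Equiv.Perm.inv_eq_iff_eq] at this
      · rw [hπv, hπv', htv, htv', map_one, Equiv.Perm.one_apply]

/-- The subgroup fixing the unknown `x v` according to the left loops. -/
def leftStabilizer (𝒮 : BipartiteSystem A B V W) (v : V) : Subgroup A :=
  Subgroup.closure {a | (v, a) ∈ 𝒮.leftLoops}

/-- The subgroup fixing the unknown `y w` according to the right loops. -/
def rightStabilizer (𝒮 : BipartiteSystem A B V W) (w : W) : Subgroup B :=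
  𝒮.swap.leftStabilizer w

theorem IsSolution.apply_eq_of_mem_leftStabilizer {𝒮 : BipartiteSystem A B V W} {Z : Type*}
    {φ : A →* Equiv.Perm Z} {ψ : B →* Equiv.Perm Z} {x : V → Z} {y : W → Z}
    (h : 𝒮.IsSolution φ ψ x y) {v : V} {a : A} (ha : a ∈ 𝒮.leftStabilizer v) :
    φ a (x v) = x v := by
  induction ha using Subgroup.closure_induction with
  | mem a ha => exact h.left _ ha
  | one => simp
  | mul a b _ _ ha hb => simp [ha, hb]
  | inv a _ ha => rw [map_inv, Equiv.Perm.inv_eq_iff_eq, ha]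

/-- The point of the homogeneous spaces over `V` that an edge determines. -/
def leftCoset (𝒮 : BipartiteSystem A B V W) (e : V × A × B × W) :
    Σ v, A ⧸ 𝒮.leftStabilizer v :=
  ⟨e.1, e.2.1⟩

/-- The point of the homogeneous spaces over `W` that an edge determines. -/
def rightCoset (𝒮 : BipartiteSystem A B V W) (e : V × A × B × W) :
    Σ w, B ⧸ 𝒮.rightStabilizer w :=
  ⟨e.2.2.2, e.2.2.1⟩

/-- Two edges that determine the same point over `V` can be folded. -/
theorem exists_fold [Fintype V] [Fintype W] [Nonempty V] [Nonempty W]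
    {𝒮 : BipartiteSystem A B V W} (hr : 𝒮.IsRigid) {n : ℕ} (hn : 𝒮.ComplexityLE n)
    {e e' : V × A × B × W} {E : Multiset (V × A × B × W)} (hE : 𝒮.edges = e ::ₘ e' ::ₘ E)
    (he : 𝒮.leftCoset e = 𝒮.leftCoset e') :
    ∃ (W' : Type) (_ : Fintype W') (_ : Nonempty W') (𝒮₁ : BipartiteSystem A B V W'),
      𝒮₁.IsRigid ∧ 𝒮₁.ComplexityLE n ∧ 𝒮₁.edges.card < 𝒮.edges.card := by
  -- Given `e`, the equation `e'` only says that the two unknowns over `W` are translates of each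
  -- other. Dropping it and gluing these unknowns lowers and then raises the complexity by one.
  let 𝒮₂ : BipartiteSystem A B V W := ⟨e ::ₘ E, 𝒮.leftLoops, 𝒮.rightLoops⟩
  obtain ⟨W', i1, i2, 𝒮₁, π, t, h1, h2, h2', hπ, -, h3⟩ :=
    𝒮₂.swap.exists_glue e.2.2.2 e'.2.2.2 (e'.2.2.1⁻¹ * e.2.2.1)
  refine ⟨W', i1, i2, 𝒮₁.swap, ?_, ?_, ?_⟩
  · intro Z φ ψ x y hs
    obtain ⟨h4, h5⟩ := h3 Z ψ φ y x (by simpa using hs.swap)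
    replace h4 := h4.swap
    rw [swap_swap] at h4
    have h6 := h4.edge e (Multiset.mem_cons_self _ _)
    obtain ⟨v, a, b, w⟩ := e
    obtain ⟨v', a', b', w'⟩ := e'
    simp only [leftCoset, Sigma.mk.injEq] at he
    obtain ⟨rfl, he⟩ := he
    have h7 := h4.apply_eq_of_mem_leftStabilizer (v := v) (a := a⁻¹ * a')
      (QuotientGroup.eq.1 (eq_of_heq he))
    simp only [map_mul, map_inv, Equiv.Perm.mul_apply, Equiv.Perm.inv_eq_iff_eq] at h5 h6 h7
    obtain ⟨z, h8, h9, h10, h11⟩ := hr Z φ ψ x (fun j => ψ (t j) (y (π j))) (by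
      refine ⟨fun f hf => ?_, h4.left, h4.right⟩
      rw [hE, Multiset.mem_cons, Multiset.mem_cons] at hf
      rcases hf with rfl | rfl | hf
      · exact h6
      · dsimp only
        rw [h7, h6, h5]
        exact ((ψ b').apply_symm_apply _).symm
      · exact h4.edge f (Multiset.mem_cons_of_mem hf))
    refine ⟨z, h8, fun j => ?_, h10, h11⟩
    obtain ⟨i, rfl⟩ := hπ j
    rw [← (ψ (t i)).injective.eq_iff, h9, h11]
  · refine ComplexityLE.swap ?_
    simp only [ComplexityLE, swap, 𝒮₂, hE, Multiset.card_map, Multiset.card_cons] at hn h1 h2 h2' ⊢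
    rw [h2']
    omega
  · simp [swap, h1, 𝒮₂, hE]

/-- A bipartite system is left unfolded if distinct edges determine distinct points over `V`. -/
def IsLeftUnfolded (𝒮 : BipartiteSystem A B V W) : Prop :=
  ∀ e e' E, 𝒮.edges = e ::ₘ e' ::ₘ E → 𝒮.leftCoset e ≠ 𝒮.leftCoset e'

theorem IsLeftUnfolded.injOn {𝒮 : BipartiteSystem A B V W} (h : 𝒮.IsLeftUnfolded)
    {e e' : V × A × B × W} (he : e ∈ 𝒮.edges) (he' : e' ∈ 𝒮.edges)
    (hee : 𝒮.leftCoset e = 𝒮.leftCoset e') : e = e' := by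
  by_contra hne
  obtain ⟨E, hE⟩ := Multiset.exists_cons_of_mem he
  rw [hE, Multiset.mem_cons] at he'
  obtain ⟨E', rfl⟩ := Multiset.exists_cons_of_mem (he'.resolve_left (Ne.symm hne))
  exact h e e' E' hE hee

theorem IsLeftUnfolded.injOn_right {𝒮 : BipartiteSystem A B V W} (h : 𝒮.swap.IsLeftUnfolded)
    {e e' : V × A × B × W} (he : e ∈ 𝒮.edges) (he' : e' ∈ 𝒮.edges)
    (hee : 𝒮.rightCoset e = 𝒮.rightCoset e') : e = e' := by
  have := h.injOn (Multiset.mem_map_of_mem _ he) (Multiset.mem_map_of_mem _ he') hee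
  simp only [Prod.mk.injEq] at this
  ext <;> simp [this]

theorem rank_le_card_leftLoops [Group.FG A] {𝒮 : BipartiteSystem A B V W} [Subsingleton V] {v : V}
    (h : 𝒮.leftStabilizer v = ⊤) : Group.rank A ≤ 𝒮.leftLoops.card := by
  classical
  have : ((𝒮.leftLoops.map Prod.snd).toFinset : Set A) = {a | (v, a) ∈ 𝒮.leftLoops} := by
    ext a
    simp only [Finset.mem_coe, Multiset.mem_toFinset, Multiset.mem_map, Prod.exists, exists_eq_right,
      Set.mem_ofPred_eq]
    exact ⟨fun ⟨i, hi⟩ => Subsingleton.elim v i ▸ hi, fun hi => ⟨v, hi⟩⟩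
  refine (Group.rank_le (S := (𝒮.leftLoops.map Prod.snd).toFinset) (by rw [this]; exact h)).trans ?_
  exact (Multiset.toFinset_card_le _).trans (Multiset.card_map _ _).le

/-- A rigid system without folds consists of one edge and of loops that generate both groups. -/
theorem rank_add_rank_le_of_unfolded [Group.FG A] [Group.FG B] [Fintype V] [Fintype W] [Nonempty V]
    [Nonempty W] {𝒮 : BipartiteSystem A B V W} (hr : 𝒮.IsRigid) {n : ℕ} (hn : 𝒮.ComplexityLE n)
    (hA : 𝒮.IsLeftUnfolded) (hB : 𝒮.swap.IsLeftUnfolded) : Group.rank A + Group.rank B ≤ n := by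
  classical
  let ZA := Σ v, A ⧸ 𝒮.leftStabilizer v
  let ZB := Σ w, B ⧸ 𝒮.rightStabilizer w
  -- A test solution: the homogeneous spaces of both groups, with the two points determined by each
  -- edge identified through `j`. Each group acts on its own spaces and fixes all other points.
  -- Unfoldedness over `W` makes the identification independent of the chosen edge, unfoldedness
  -- over `V` makes it injective.
  let j : ZB → ZA ⊕ ZB := fun z =>
    if h : ∃ e ∈ 𝒮.edges, 𝒮.rightCoset e = z then .inl (𝒮.leftCoset h.choose) else .inr z
  have hj : Function.Injective j := by
    intro z z' hz
    simp only [j] at hz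
    split_ifs at hz with h h'
    · rw [← h.choose_spec.2, ← h'.choose_spec.2,
        hA.injOn h.choose_spec.1 h'.choose_spec.1 (Sum.inl_injective hz)]
    · exact Sum.inr_injective hz
  have hje : ∀ e ∈ 𝒮.edges, j (𝒮.rightCoset e) = .inl (𝒮.leftCoset e) := by
    intro e he
    have h : ∃ e' ∈ 𝒮.edges, 𝒮.rightCoset e' = 𝒮.rightCoset e := ⟨e, he, rfl⟩
    rw [show j _ = _ from dif_pos h, hB.injOn_right h.choose_spec.1 he h.choose_spec.2]
  let iA : ZA ↪ ZA ⊕ ZB := ⟨Sum.inl, Sum.inl_injective⟩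
  let iB : ZB ↪ ZA ⊕ ZB := ⟨j, hj⟩
  let φ : A →* Equiv.Perm (ZA ⊕ ZB) :=
    (Equiv.Perm.viaEmbeddingHom iA).comp (MulAction.toPermHom A ZA)
  let ψ : B →* Equiv.Perm (ZA ⊕ ZB) :=
    (Equiv.Perm.viaEmbeddingHom iB).comp (MulAction.toPermHom B ZB)
  have hφ : ∀ (a : A) (z : ZA), φ a (.inl z) = .inl (a • z) := fun a z =>
    Equiv.Perm.viaEmbedding_apply _ iA z
  have hψ : ∀ (b : B) (z : ZB), ψ b (j z) = j (b • z) := fun b z =>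
    Equiv.Perm.viaEmbedding_apply _ iB z
  let x : V → ZA ⊕ ZB := fun v => .inl ⟨v, (1 : A)⟩
  let y : W → ZA ⊕ ZB := fun w => j ⟨w, (1 : B)⟩
  have hφx : ∀ a v, φ a (x v) = .inl ⟨v, (a : A)⟩ := by
    intro a v
    rw [hφ, Sigma.smul_mk, MulAction.Quotient.smul_coe, smul_eq_mul, mul_one]
  have hψy : ∀ b w, ψ b (y w) = j ⟨w, (b : B)⟩ := by
    intro b w
    rw [hψ, Sigma.smul_mk, MulAction.Quotient.smul_coe, smul_eq_mul, mul_one]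
  obtain ⟨z, h1, h2, h3, h4⟩ := hr (ZA ⊕ ZB) φ ψ x y (by
    refine ⟨fun e he => ?_, fun s hs => ?_, fun s hs => ?_⟩
    · rw [hφx, hψy]
      exact (hje e he).symm
    · rw [hφx]
      refine congrArg _ (Sigma.ext rfl (heq_of_eq (QuotientGroup.eq.2 ?_)))
      exact Subgroup.mul_mem _ (Subgroup.inv_mem _ (Subgroup.subset_closure hs)) (one_mem _)
    · rw [hψy]
      refine congrArg _ (Sigma.ext rfl (heq_of_eq (QuotientGroup.eq.2 ?_)))
      exact Subgroup.mul_mem _ (Subgroup.inv_mem _ (Subgroup.subset_closure hs)) (one_mem _))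
  have hV : Subsingleton V := ⟨fun v v' =>
    congrArg Sigma.fst (Sum.inl_injective ((h1 v).trans (h1 v').symm))⟩
  have hW : Subsingleton W := ⟨fun w w' =>
    congrArg Sigma.fst (hj ((h2 w).trans (h2 w').symm))⟩
  obtain ⟨v⟩ := ‹Nonempty V›
  obtain ⟨w⟩ := ‹Nonempty W›
  have hAv : 𝒮.leftStabilizer v = ⊤ := by
    rw [Subgroup.eq_top_iff']
    intro a
    have := (hφx a v).symm.trans ((congrArg _ (h1 v)).trans ((h3 a).trans (h1 v).symm))
    have := QuotientGroup.eq.1 (eq_of_heq (Sigma.mk.inj (Sum.inl_injective this)).2)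
    simpa using this
  have hBw : 𝒮.swap.leftStabilizer w = ⊤ := by
    rw [Subgroup.eq_top_iff']
    intro b
    have := (hψy b w).symm.trans ((congrArg _ (h2 w)).trans ((h4 b).trans (h2 w).symm))
    have := QuotientGroup.eq.1 (eq_of_heq (Sigma.mk.inj (hj this)).2)
    simpa [rightStabilizer] using this
  -- Without edges nothing is identified, and the test solution takes values in both summands. In
  -- the final count this edge and the `+ 1` of the complexity offset the two unknowns.
  have hE : 0 < 𝒮.edges.card := by
    rw [Multiset.card_pos_iff_exists_mem]
    by_contra hne
    have h5 : j ⟨w, (1 : B)⟩ = .inr ⟨w, (1 : B)⟩ := dif_neg fun ⟨e, he, _⟩ => hne ⟨e, he⟩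
    exact Sum.inl_ne_inr (((h1 v).trans (h2 w).symm).trans h5)
  have h5 := rank_le_card_leftLoops hAv
  have h6 := rank_le_card_leftLoops hBw
  have h7 : Fintype.card V ≤ 1 := Fintype.card_le_one_iff_subsingleton.2 hV
  have h8 : Fintype.card W ≤ 1 := Fintype.card_le_one_iff_subsingleton.2 hW
  simp only [ComplexityLE, swap] at hn h6
  omega

/-- Every fold removes an edge and preserves rigidity and the complexity bound, so folding on either
side ends at an unfolded system. -/
theorem IsRigid.rank_add_rank_le [Group.FG A] [Group.FG B] {n : ℕ} (m : ℕ) :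
    ∀ {V W : Type} [Fintype V] [Fintype W] [Nonempty V] [Nonempty W]
      {𝒮 : BipartiteSystem A B V W}, 𝒮.IsRigid → 𝒮.ComplexityLE n → 𝒮.edges.card = m →
      Group.rank A + Group.rank B ≤ n := by
  induction m using Nat.strong_induction_on with
  | _ m ih =>
    intro V W _ _ _ _ 𝒮 hr hn hm
    by_cases hA : 𝒮.IsLeftUnfolded
    · by_cases hB : 𝒮.swap.IsLeftUnfolded
      · exact rank_add_rank_le_of_unfolded hr hn hA hB
      · simp only [IsLeftUnfolded, not_forall, not_not] at hB
        obtain ⟨e, e', E, hE, he⟩ := hB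
        obtain ⟨V', i1, i2, 𝒮₁, h1, h2, h3⟩ := exists_fold hr.swap hn.swap hE he
        refine ih _ ?_ h1.swap h2.swap rfl
        simpa [BipartiteSystem.swap, ← hm] using h3
    · simp only [IsLeftUnfolded, not_forall, not_not] at hA
      obtain ⟨e, e', E, hE, he⟩ := hA
      obtain ⟨W', i1, i2, 𝒮₁, h1, h2, h3⟩ := exists_fold hr hn hE he
      exact ih _ (hm ▸ h3) h1 h2 rfl

end Basic

/-! ### Grushko's theorem: from generators of the free product to rigid systems. -/

section Generators

variable {A : Type u} {B : Type v} [Group A] [Group B]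

open Monoid

/-- A bipartite system with base unknown `v₀`, in which the elements of `L` fix the base unknown, and
all unknowns are equal as soon as the base unknown is fixed by both groups. -/
structure IsBased {V W : Type} (𝒮 : BipartiteSystem A B V W) (v₀ : V) (L : Set (Coprod A B)) :
    Prop where
  fixed : ∀ (Z : Type (max u v)) (φ : A →* Equiv.Perm Z) (ψ : B →* Equiv.Perm Z) (x : V → Z)
    (y : W → Z), 𝒮.IsSolution φ ψ x y → ∀ q ∈ L, Coprod.lift φ ψ q (x v₀) = x v₀
  const : ∀ (Z : Type (max u v)) (φ : A →* Equiv.Perm Z) (ψ : B →* Equiv.Perm Z) (x : V → Z)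
    (y : W → Z), 𝒮.IsSolution φ ψ x y → (∀ q, Coprod.lift φ ψ q (x v₀) = x v₀) →
      (∀ i, x i = x v₀) ∧ ∀ j, y j = x v₀

/-- The elements that fix the base value form a subgroup; as it contains `L`, it is everything, and
the base value then propagates to all unknowns. -/
theorem IsBased.isRigid {V W : Type} {𝒮 : BipartiteSystem A B V W} {v₀ : V}
    {L : Set (Coprod A B)} (h : 𝒮.IsBased v₀ L) (hL : Subgroup.closure L = ⊤) : 𝒮.IsRigid := by
  intro Z φ ψ x y hs
  have hfix : ∀ q, Coprod.lift φ ψ q (x v₀) = x v₀ := by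
    intro q
    have hq : q ∈ Subgroup.closure L := hL ▸ Subgroup.mem_top q
    induction hq using Subgroup.closure_induction with
    | mem a ha => exact h.fixed Z φ ψ x y hs a ha
    | one => simp
    | mul a b _ _ ha hb => rw [map_mul, Equiv.Perm.mul_apply, hb, ha]
    | inv a _ ha => rw [map_inv, Equiv.Perm.inv_eq_iff_eq, ha]
  obtain ⟨h1, h2⟩ := h.const Z φ ψ x y hs hfix
  exact ⟨x v₀, h1, h2, fun a => by simpa using hfix (Coprod.inl a),
    fun b => by simpa using hfix (Coprod.inr b)⟩

/-- A based system can be enlarged by an unknown whose value is a prescribed translate of the base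
unknown. -/
theorem IsBased.exists_translate {n : ℕ} {L : Set (Coprod A B)} {V W : Type} [Fintype V]
    [Fintype W] [Nonempty W] {𝒮 : BipartiteSystem A B V W} {v₀ : V} (h : 𝒮.IsBased v₀ L)
    (hn : 𝒮.ComplexityLE n) (q : Coprod A B) :
    ∃ (V' W' : Type) (_ : Fintype V') (_ : Fintype W') (_ : Nonempty W')
      (𝒮₁ : BipartiteSystem A B V' W') (v₁ v₂ : V'), 𝒮₁.IsBased v₁ L ∧ 𝒮₁.ComplexityLE n ∧
      ∀ (Z : Type (max u v)) (φ : A →* Equiv.Perm Z) (ψ : B →* Equiv.Perm Z) (x : V' → Z)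
        (y : W' → Z), 𝒮₁.IsSolution φ ψ x y → x v₂ = Coprod.lift φ ψ q (x v₁) := by
  have step : ∀ (a : A) (b : B) (q : Coprod A B),
      (∃ (V' W' : Type) (_ : Fintype V') (_ : Fintype W') (_ : Nonempty W')
        (𝒮₁ : BipartiteSystem A B V' W') (v₁ v₂ : V'), 𝒮₁.IsBased v₁ L ∧ 𝒮₁.ComplexityLE n ∧
        ∀ (Z : Type (max u v)) (φ : A →* Equiv.Perm Z) (ψ : B →* Equiv.Perm Z) (x : V' → Z)
          (y : W' → Z), 𝒮₁.IsSolution φ ψ x y → x v₂ = Coprod.lift φ ψ q (x v₁)) →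
      ∃ (V' W' : Type) (_ : Fintype V') (_ : Fintype W') (_ : Nonempty W')
        (𝒮₁ : BipartiteSystem A B V' W') (v₁ v₂ : V'), 𝒮₁.IsBased v₁ L ∧ 𝒮₁.ComplexityLE n ∧
        ∀ (Z : Type (max u v)) (φ : A →* Equiv.Perm Z) (ψ : B →* Equiv.Perm Z) (x : V' → Z)
          (y : W' → Z), 𝒮₁.IsSolution φ ψ x y →
            x v₂ = Coprod.lift φ ψ (Coprod.inr b * (Coprod.inl a * q)) (x v₁) := by
    rintro a b q ⟨V, W, _, _, _, 𝒮, v₁, v₂, h, hn, hv⟩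
    -- Two new unknowns, `y none = a • x v₂` and `x none = b • y none`, come with two new equations,
    -- so the complexity does not change.
    let 𝒮₁ : BipartiteSystem A B (Option V) (Option W) :=
      ⟨(some v₂, a, 1, none) ::ₘ (none, 1, b, none) ::ₘ
          𝒮.edges.map fun e => (some e.1, e.2.1, e.2.2.1, some e.2.2.2),
        𝒮.leftLoops.map fun s => (some s.1, s.2), 𝒮.rightLoops.map fun s => (some s.1, s.2)⟩
    have key : ∀ (Z : Type (max u v)) (φ : A →* Equiv.Perm Z) (ψ : B →* Equiv.Perm Z)
        (x : Option V → Z) (y : Option W → Z), 𝒮₁.IsSolution φ ψ x y →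
        𝒮.IsSolution φ ψ (fun i => x (some i)) (fun j => y (some j)) ∧ φ a (x (some v₂)) = y none ∧
          x none = ψ b (y none) := by
      intro Z φ ψ x y hs
      refine ⟨⟨fun e he => ?_, fun s hs' => ?_, fun s hs' => ?_⟩, ?_, ?_⟩
      · exact hs.edge _ (Multiset.mem_cons_of_mem
          (Multiset.mem_cons_of_mem (Multiset.mem_map_of_mem _ he)))
      · exact hs.left _ (Multiset.mem_map_of_mem _ hs')
      · exact hs.right _ (Multiset.mem_map_of_mem _ hs')
      · simpa using hs.edge _ (Multiset.mem_cons_self _ _)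
      · simpa using hs.edge _ (Multiset.mem_cons_of_mem (Multiset.mem_cons_self _ _))
    refine ⟨Option V, Option W, inferInstance, inferInstance, inferInstance, 𝒮₁, some v₁, none,
      ⟨?_, ?_⟩, ?_, ?_⟩
    · intro Z φ ψ x y hs
      exact h.fixed Z φ ψ _ _ (key Z φ ψ x y hs).1
    · intro Z φ ψ x y hs hfix
      obtain ⟨h1, h2, h3⟩ := key Z φ ψ x y hs
      obtain ⟨h4, h5⟩ := h.const Z φ ψ _ _ h1 hfix
      have h6 : y none = x (some v₁) := by
        rw [← h2, h4]
        simpa using hfix (Coprod.inl a)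
      have h7 : x none = x (some v₁) := by
        rw [h3, h6]
        simpa using hfix (Coprod.inr b)
      exact ⟨fun i => by cases i with | none => exact h7 | some i => exact h4 i,
        fun j => by cases j with | none => exact h6 | some j => exact h5 j⟩
    · simp only [ComplexityLE, 𝒮₁, Multiset.card_cons, Multiset.card_map, Fintype.card_option] at hn ⊢
      omega
    · intro Z φ ψ x y hs
      obtain ⟨h1, h2, h3⟩ := key Z φ ψ x y hs
      have h4 := hv Z φ ψ _ _ h1
      simp only [map_mul, Coprod.lift_apply_inl, Coprod.lift_apply_inr, Equiv.Perm.mul_apply]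
      rw [← h4, h2, h3]
  induction q using Coprod.induction_on' with
  | one => exact ⟨V, W, ‹_›, ‹_›, ‹_›, 𝒮, v₀, v₀, h, hn, by simp⟩
  | inl_mul a q ih => simpa only [map_one, one_mul] using step a 1 q ih
  | inr_mul b q ih => simpa only [map_one, one_mul] using step 1 b q ih

/-- The empty set corresponds to a single equation between two unknowns. To make a further `q` fix
the base unknown, its translate by `q` is adjoined at no cost and then glued to it, which costs one.
-/
theorem exists_isBased (L : Finset (Coprod A B)) :
    ∃ (V W : Type) (_ : Fintype V) (_ : Fintype W) (_ : Nonempty W)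
      (𝒮 : BipartiteSystem A B V W) (v₀ : V), 𝒮.IsBased v₀ L ∧ 𝒮.ComplexityLE L.card := by
  classical
  induction L using Finset.induction_on with
  | empty =>
    refine ⟨Unit, Unit, inferInstance, inferInstance, inferInstance, ⟨{((), 1, 1, ())}, 0, 0⟩, (),
      ⟨by simp, ?_⟩, by simp [ComplexityLE]⟩
    intro Z φ ψ x y hs _
    have := hs.edge ((), 1, 1, ()) (Multiset.mem_singleton_self _)
    exact ⟨fun _ => rfl, fun _ => by simpa using this.symm⟩
  | insert q L hq ih =>
    obtain ⟨V, W, _, _, _, 𝒮, v₀, h, hn⟩ := ih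
    obtain ⟨V, W, _, _, _, 𝒮, v₁, v₂, h, hn, hv⟩ := h.exists_translate hn q
    have : Nonempty V := ⟨v₁⟩
    obtain ⟨V', _, _, 𝒮₁, π, t, h1, h2, h3, hπ, ht, h4⟩ := 𝒮.exists_glue v₁ v₂ 1
    refine ⟨V', W, ‹_›, ‹_›, ‹_›, 𝒮₁, π v₁, ⟨?_, ?_⟩, ?_⟩
    · intro Z φ ψ x y hs
      obtain ⟨h5, h6⟩ := h4 Z φ ψ x y hs
      have h7 := h.fixed Z φ ψ _ _ h5
      have h8 := hv Z φ ψ _ _ h5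
      simp only [ht, map_one, Equiv.Perm.one_apply] at h6 h7 h8
      intro q' hq'
      rcases Finset.mem_insert.1 hq' with rfl | hq'
      · rw [← h8, h6]
      · exact h7 q' hq'
    · intro Z φ ψ x y hs hfix
      obtain ⟨h5, h6⟩ := h4 Z φ ψ x y hs
      have h7 := h.const Z φ ψ _ _ h5
      simp only [ht, map_one, Equiv.Perm.one_apply] at h7
      obtain ⟨h8, h9⟩ := h7 hfix
      refine ⟨fun i => ?_, h9⟩
      obtain ⟨i, rfl⟩ := hπ i
      rw [← (φ (t i)).injective.eq_iff, h8]
      simpa using (hfix (Coprod.inl (t i))).symm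
    · rw [Finset.card_insert_of_notMem hq]
      simp only [ComplexityLE] at hn ⊢
      rw [h3]
      omega

end Generators

end BipartiteSystem

open Monoid in
/-- **Grushko's theorem**, the nontrivial inequality. -/
theorem Group.rank_add_rank_le_rank_coprod (A B : Type*) [Group A] [Group B] [Group.FG A]
    [Group.FG B] [Group.FG (Coprod A B)] :
    Group.rank A + Group.rank B ≤ Group.rank (Coprod A B) := by
  obtain ⟨L, hL, hL'⟩ := Group.rank_spec (Coprod A B)
  obtain ⟨V, W, _, _, _, 𝒮, v₀, h, hn⟩ := BipartiteSystem.exists_isBased L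
  have : Nonempty V := ⟨v₀⟩
  exact hL ▸ (h.isRigid hL').rank_add_rank_le _ hn rfl

/-! ### Ranks of finite free products. -/

section FreeProducts

open Monoid

instance Monoid.Coprod.instGroupFG (A B : Type*) [Group A] [Group B] [Group.FG A] [Group.FG B] :
    Group.FG (Coprod A B) := by
  rw [Group.fg_iff_monoid_fg]
  constructor
  rw [← Coprod.mrange_inl_sup_mrange_inr]
  exact Submonoid.FG.sup ((Monoid.fg_iff_submonoid_fg _).1 (Monoid.fg_range _))
    ((Monoid.fg_iff_submonoid_fg _).1 (Monoid.fg_range _))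

instance Monoid.CoprodI.instGroupFG {I : Type*} [Finite I] (A : I → Type*) [∀ i, Group (A i)]
    [∀ i, Group.FG (A i)] : Group.FG (CoprodI A) := by
  rw [Group.fg_iff_monoid_fg]
  constructor
  rw [← CoprodI.iSup_mrange_of]
  exact Submonoid.FG.iSup _ fun i => (Monoid.fg_iff_submonoid_fg _).1 (Monoid.fg_range _)

theorem Group.sum_rank_le_rank_coprodI {I : Type*} (A : I → Type*) [∀ i, Group (A i)]
    [∀ i, Group.FG (A i)] (s : Finset I) :
    ∑ i ∈ s, Group.rank (A i) ≤ Group.rank (CoprodI fun i : s => A i) := by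
  classical
  induction s using Finset.induction_on with
  | empty => simp
  | insert i s hi ih =>
    rw [Finset.sum_insert hi]
    refine (Nat.add_le_add_left ih _).trans
      ((Group.rank_add_rank_le_rank_coprod (A i) (CoprodI fun j : s => A j)).trans ?_)
    -- Rank does not increase under surjections, so a surjection onto the binary free product
    -- suffices.
    let g : ∀ j : (insert i s : Finset I), A j →* Coprod (A i) (CoprodI fun j : s => A j) := fun j =>
      if h : j.1 = i then
        Eq.rec (motive := fun k _ => A k →* Coprod (A i) (CoprodI fun j : s => A j)) Coprod.inl h.symm
      else Coprod.inr.comp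
        (CoprodI.of (M := fun j : s => A j)
          (i := (⟨j.1, (Finset.mem_insert.1 j.2).resolve_left h⟩ : s)))
    refine Group.rank_le_of_surjective (CoprodI.lift g) ?_
    rw [← MonoidHom.range_eq_top, Subgroup.eq_top_iff']
    intro q
    induction q using Coprod.induction_on with
    | inl a =>
      refine ⟨CoprodI.of (i := (⟨i, Finset.mem_insert_self i s⟩ : (insert i s : Finset I))) a, ?_⟩
      rw [CoprodI.lift_of]
      simp [g]
    | inr x =>
      induction x using CoprodI.induction_on with
      | one => simp
      | of j a =>
        refine ⟨CoprodI.of (i := (⟨j, Finset.mem_insert_of_mem j.2⟩ : (insert i s : Finset I))) a, ?_⟩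
        have hj : j.1 ≠ i := fun h => hi (h ▸ j.2)
        rw [CoprodI.lift_of]
        simp [g, hj]
      | mul x y hx hy => rw [map_mul]; exact mul_mem hx hy
    | mul x y hx hy => exact mul_mem hx hy

/-- There are `2 ^ |M|` homomorphisms to the group of order two, and each is determined by its
values on a generating set. -/
theorem Group.card_le_rank_freeGroup (M : Type*) [Finite M] :
    Nat.card M ≤ Group.rank (FreeGroup M) := by
  obtain ⟨S, hS, hS'⟩ := Group.rank_spec (FreeGroup M)
  let C := Multiplicative (ZMod 2)
  have hC : Nat.card C = 2 := by simp [C]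
  have : Finite C := Nat.finite_of_card_ne_zero (by omega)
  have hinj : Function.Injective fun (f : FreeGroup M →* C) (s : S) => f s := by
    intro f g hfg
    exact MonoidHom.eq_of_eqOn_dense hS' fun s hs => congrFun hfg ⟨s, hs⟩
  have h1 := Nat.card_le_card_of_injective _ hinj
  rw [← Nat.card_congr FreeGroup.lift, Nat.card_fun, Nat.card_fun, hC] at h1
  rw [← hS]
  simpa using (Nat.pow_le_pow_iff_right (by norm_num)).1 h1

theorem Group.sum_rank_add_card_le_rank {I M : Type*} [Fintype I] [Finite M] (A : I → Type*)
    [∀ i, Group (A i)] [∀ i, Group.FG (A i)] :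
    ∑ i, Group.rank (A i) + Nat.card M ≤ Group.rank (Coprod (CoprodI A) (FreeGroup M)) := by
  refine (add_le_add ?_ (Group.card_le_rank_freeGroup M)).trans
    (Group.rank_add_rank_le_rank_coprod _ _)
  refine (Group.sum_rank_le_rank_coprodI A Finset.univ).trans ?_
  refine Group.rank_le_of_surjective
    (CoprodI.lift fun i => CoprodI.of (M := fun i : (Finset.univ : Finset I) => A i) (i := (⟨i, Finset.mem_univ i⟩ : (Finset.univ : Finset I)))) ?_
  rw [← MonoidHom.range_eq_top, Subgroup.eq_top_iff']
  intro x
  induction x using CoprodI.induction_on with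
  | one => exact one_mem _
  | of j a => exact ⟨CoprodI.of (i := j.1) a, by rw [CoprodI.lift_of]⟩
  | mul x y hx hy => exact mul_mem hx hy

end FreeProducts

/-! ### Spanning trees and integration along them. -/

section Spanning

/-- A finite connected multigraph with edges `M` and vertices `N` has a spanning tree, in the form
of a set of `|N| - 1` edges along which any prescribed increments can be integrated. -/
theorem exists_spanning.{w, u, v} {M : Type u} {N : Type v} [Finite N] [Nonempty N] (o t : M → N)
    (hconn : ∀ C : Set N, (∀ m, o m ∈ C ↔ t m ∈ C) → C.Nonempty → C = Set.univ) :
    ∃ S : Finset M, S.card + 1 = Nat.card N ∧ ∀ (K : Type w) [Group K] (σ : M → K),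
      ∃ d : N → K, ∀ m ∈ S, d (o m) = σ m * d (t m) := by
  classical
  -- A tree with `k` edges on a vertex set `C` grows by an edge with exactly one end in `C`, which
  -- exists by connectedness. The new end meets no earlier edge, so the new equation can be solved
  -- for its value.
  have key : ∀ k, k + 1 ≤ Nat.card N → ∃ (C : Finset N) (S : Finset M), C.card = k + 1 ∧
      S.card = k ∧ (∀ m ∈ S, o m ∈ C ∧ t m ∈ C) ∧ ∀ (K : Type w) [Group K] (σ : M → K),
      ∃ d : N → K, ∀ m ∈ S, d (o m) = σ m * d (t m) := by
    intro k
    induction k with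
    | zero =>
      intro _
      obtain ⟨n⟩ := ‹Nonempty N›
      exact ⟨{n}, ∅, by simp, by simp, by simp, fun K _ σ => ⟨1, by simp⟩⟩
    | succ k ih =>
      intro hk
      obtain ⟨C, S, hC, hS, hCS, hd⟩ := ih (by omega)
      have hne : ¬ ∀ m, o m ∈ C ↔ t m ∈ C := by
        intro h
        have h1 : (C : Set N) = Set.univ := hconn C h (by
          rw [Finset.coe_nonempty, ← Finset.card_pos]
          omega)
        have h2 : Nat.card N = C.card := by
          rw [← Set.ncard_univ, ← h1, Set.ncard_coe_finset]
        omega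
      push Not at hne
      obtain ⟨m, hm⟩ := hne
      have hmS : m ∉ S := fun h => by
        have := hCS m h
        tauto
      rcases hm with ⟨h1, h2⟩ | ⟨h1, h2⟩
      · refine ⟨insert (t m) C, insert m S, by rw [Finset.card_insert_of_notMem h2, hC],
          by rw [Finset.card_insert_of_notMem hmS, hS], ?_, ?_⟩
        · intro m' hm'
          rcases Finset.mem_insert.1 hm' with rfl | hm'
          · simp [h1]
          · simp [hCS m' hm']
        · intro K _ σ
          obtain ⟨d, hd⟩ := hd K σ
          refine ⟨Function.update d (t m) ((σ m)⁻¹ * d (o m)), fun m' hm' => ?_⟩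
          rcases Finset.mem_insert.1 hm' with rfl | hm'
          · rw [Function.update_self, Function.update_of_ne (fun h : o m' = t m' => h2 (h ▸ h1)),
              mul_inv_cancel_left]
          · rw [Function.update_of_ne fun h : o m' = t m => h2 (h ▸ (hCS m' hm').1),
              Function.update_of_ne fun h : t m' = t m => h2 (h ▸ (hCS m' hm').2), hd m' hm']
      · refine ⟨insert (o m) C, insert m S, by rw [Finset.card_insert_of_notMem h1, hC],
          by rw [Finset.card_insert_of_notMem hmS, hS], ?_, ?_⟩
        · intro m' hm'
          rcases Finset.mem_insert.1 hm' with rfl | hm'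
          · simp [h2]
          · simp [hCS m' hm']
        · intro K _ σ
          obtain ⟨d, hd⟩ := hd K σ
          refine ⟨Function.update d (o m) (σ m * d (t m)), fun m' hm' => ?_⟩
          rcases Finset.mem_insert.1 hm' with rfl | hm'
          · rw [Function.update_self, Function.update_of_ne (fun h : t m' = o m' => h1 (h ▸ h2))]
          · rw [Function.update_of_ne fun h : o m' = o m => h1 (h ▸ (hCS m' hm').1),
              Function.update_of_ne fun h : t m' = o m => h1 (h ▸ (hCS m' hm').2), hd m' hm']
  have hpos : 0 < Nat.card N := Nat.card_pos
  obtain ⟨C, S, -, hS, -, hd⟩ := key (Nat.card N - 1) (by omega)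
  exact ⟨S, by omega, hd⟩

namespace GraphOfGroups

variable {V E : Type*} {𝒢 : GraphOfGroups V E} {T : Set E}

theorem IsMaximalTree.nonempty (hT : 𝒢.IsMaximalTree T) : Nonempty V :=
  hT.isTree.connected.nonempty

theorem IsMaximalTree.eq_univ_of_closed (hT : 𝒢.IsMaximalTree T) {C : Set V}
    (hC : ∀ e ∈ T, 𝒢.origin e ∈ C ↔ 𝒢.terminus e ∈ C) (hne : C.Nonempty) : C = Set.univ := by
  obtain ⟨u, hu⟩ := hne
  refine Set.eq_univ_of_forall fun v => ?_
  obtain ⟨p⟩ := hT.isTree.connected.preconnected u v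
  induction p with
  | nil => exact hu
  | cons h p ih =>
    refine ih ?_
    rw [SimpleGraph.fromEdgeSet_adj] at h
    obtain ⟨⟨e, he, hee⟩, -⟩ := h
    have := hC e he
    rcases Sym2.eq_iff.1 hee with ⟨rfl, rfl⟩ | ⟨rfl, rfl⟩ <;> tauto

/-- Prescribed increments along a maximal tree can be integrated. -/
theorem IsMaximalTree.exists_integral [Finite V] [Finite E] (hT : 𝒢.IsMaximalTree T) {K : Type*}
    [Group K] (σ : E → K) :
    ∃ d : V → K, ∀ e ∈ T, d (𝒢.origin e) = σ e * d (𝒢.terminus e) := by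
  classical
  have := hT.nonempty
  have := Fintype.ofFinite V
  have := Fintype.ofFinite E
  obtain ⟨S, hS, hd⟩ := exists_spanning (fun e : T => 𝒢.origin e) (fun e => 𝒢.terminus e)
    fun C hC hne => hT.eq_univ_of_closed (fun e he => hC ⟨e, he⟩) hne
  have h1 := hT.isTree.card_edgeFinset
  have h2 : Fintype.card T = (SimpleGraph.fromEdgeSet
      ((fun e => s(𝒢.origin e, 𝒢.terminus e)) '' T)).edgeFinset.card := by
    rw [← Set.toFinset_card, ← Finset.card_image_of_injOn (s := T.toFinset)
      (f := fun e => s(𝒢.origin e, 𝒢.terminus e)) (by simpa using hT.not_parallel)]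
    congr 1
    ext x
    simp only [Finset.mem_image, Set.mem_toFinset, SimpleGraph.mem_edgeFinset,
      SimpleGraph.edgeSet_fromEdgeSet, Set.mem_sdiff, Set.mem_image]
    constructor
    · rintro ⟨e, he, rfl⟩
      exact ⟨⟨e, he, rfl⟩, fun h => hT.not_loop e he h⟩
    · exact fun h => h.1
  -- The spanning set `S` inside `T` and `T` itself both have `|V| - 1` elements.
  have h3 : S = Finset.univ := by
    rw [← Finset.card_eq_iff_eq_univ, h2]
    rw [Nat.card_eq_fintype_card] at hS
    omega
  obtain ⟨d, hd⟩ := hd K fun e => σ e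
  exact ⟨d, fun e he => hd ⟨e, he⟩ (h3 ▸ Finset.mem_univ _)⟩

end GraphOfGroups

end Spanning

/-! ### Orbits, transporters and free actions. -/

section FreeActions

variable {Γ X Y : Type*} [Group Γ] [MulAction Γ X] [MulAction Γ Y]

open MulAction

/-- The orbit of a point. -/
def orbitClass (Γ : Type*) {X : Type*} [Group Γ] [MulAction Γ X] (x : X) : orbitRel.Quotient Γ X :=
  Quotient.mk'' x

@[simp]
theorem orbitClass_out (o : orbitRel.Quotient Γ X) : orbitClass Γ o.out = o :=
  Quotient.out_eq' o

@[simp]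
theorem orbitClass_smul (a : Γ) (x : X) : orbitClass Γ (a • x) = orbitClass Γ x :=
  Quotient.sound' (mem_orbit x a)

/-- Transporters from the base points of the orbits, trivial at the base points themselves. -/
theorem exists_transporter (Γ X : Type*) [Group Γ] [MulAction Γ X] :
    ∃ r : X → Γ, (∀ x, r x • (orbitClass Γ x).out = x) ∧
      ∀ o : orbitRel.Quotient Γ X, r o.out = 1 := by
  have h : ∀ x : X, ∃ a : Γ, a • (orbitClass Γ x).out = x := fun x =>
    mem_orbit_symm.1 (orbitRel_apply.1 (Quotient.mk_out (s := orbitRel Γ X) x))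
  choose r hr using h
  refine ⟨fun x => r x * (r (orbitClass Γ x).out)⁻¹, fun x => ?_, fun o => ?_⟩
  · have := hr (orbitClass Γ x).out
    rw [orbitClass_out] at this
    rw [mul_smul, inv_smul_eq_iff.2 this.symm, hr]
  · simp only [orbitClass_out, mul_inv_cancel]

theorem transporter_smul (hfree : ∀ (a : Γ) (x : X), a • x = x → a = 1) {r : X → Γ}
    (hr : ∀ x, r x • (orbitClass Γ x).out = x) (a : Γ) (x : X) : r (a • x) = a * r x := by
  have h1 := hr (a • x)
  rw [orbitClass_smul] at h1
  refine (inv_mul_eq_one.1 (hfree ((a * r x)⁻¹ * r (a • x)) (orbitClass Γ x).out ?_)).symm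
  rw [mul_smul, h1, inv_smul_eq_iff, mul_smul, hr]

theorem card_orbits_mul_card [Finite X] (hfree : ∀ (a : Γ) (x : X), a • x = x → a = 1) :
    Nat.card (orbitRel.Quotient Γ X) * Nat.card Γ = Nat.card X := by
  rw [← Nat.card_prod]
  refine (Nat.card_congr (selfEquivOrbitsQuotientProd fun x => ?_)).symm
  exact (Subgroup.eq_bot_iff_forall _).2 fun a ha => hfree a x ha

/-- Finite sets of the same size with free actions of a finite group are isomorphic. -/
theorem exists_equivariant_equiv [Finite Γ] [Finite X] [Finite Y]
    (hX : ∀ (a : Γ) (x : X), a • x = x → a = 1) (hY : ∀ (a : Γ) (y : Y), a • y = y → a = 1)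
    (hXY : Nat.card X = Nat.card Y) : ∃ σ : X ≃ Y, ∀ (a : Γ) x, σ (a • x) = a • σ x := by
  have hcard : Nat.card (orbitRel.Quotient Γ X) = Nat.card (orbitRel.Quotient Γ Y) := by
    refine Nat.eq_of_mul_eq_mul_right (Nat.card_pos (α := Γ)) ?_
    rw [card_orbits_mul_card hX, card_orbits_mul_card hY, hXY]
  obtain ⟨ε⟩ := Finite.card_eq.1 hcard
  obtain ⟨r, hr, -⟩ := exists_transporter Γ X
  let f : X → Y := fun x => r x • (ε (orbitClass Γ x)).out
  have hf : Function.Injective f := by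
    intro x x' h
    have h1 : ε (orbitClass Γ x) = ε (orbitClass Γ x') := by
      simpa [f] using congrArg (orbitClass Γ) h
    have h2 := ε.injective h1
    simp only [f, h1] at h
    have h3 := hY ((r x')⁻¹ * r x) _ (by rw [mul_smul, h, inv_smul_smul])
    rw [← hr x, ← hr x', h2, inv_mul_eq_one.1 h3]
  refine ⟨Equiv.ofBijective f ((Nat.bijective_iff_injective_and_card f).2 ⟨hf, hXY⟩), fun a x => ?_⟩
  simp only [Equiv.ofBijective_apply, f]
  rw [transporter_smul hX hr, orbitClass_smul, mul_smul]

end FreeActions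

/-! ### Homomorphisms from the fundamental group and its finite quotients. -/

namespace GraphOfGroups

variable {V E : Type*} (𝒢 : GraphOfGroups V E) (T : Set E)

/-- The canonical homomorphism from a vertex group to the fundamental group. -/
def ofVertex (u : V) : 𝒢.vertexGroup u →* 𝒢.FundamentalGroup T :=
  (QuotientGroup.mk' _).comp (𝒢.vertexIncl u)

/-- The class of a stable letter in the fundamental group. -/
def ofEdge (e : E) : 𝒢.FundamentalGroup T :=
  QuotientGroup.mk' _ (𝒢.stableLetter e)

variable {𝒢 T}

theorem ofEdge_mul_ofVertex (e : E) (a : 𝒢.edgeGroup e) :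
    𝒢.ofEdge T e * 𝒢.ofVertex T _ (𝒢.toTerminus e a) =
      𝒢.ofVertex T _ (𝒢.toOrigin e a) * 𝒢.ofEdge T e := by
  have h := (QuotientGroup.eq_one_iff _).2 (Subgroup.subset_normalClosure (s := 𝒢.relators T)
    (Or.inl ⟨e, a, rfl⟩))
  rw [← QuotientGroup.mk'_apply] at h
  simp only [map_mul, map_inv] at h
  exact mul_inv_eq_iff_eq_mul.1 (mul_inv_eq_one.1 h)

theorem ofEdge_eq_one {e : E} (he : e ∈ T) : 𝒢.ofEdge T e = 1 :=
  (QuotientGroup.eq_one_iff _).2 (Subgroup.subset_normalClosure (Or.inr ⟨e, he, rfl⟩))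

theorem eq_top_of_mem {S : Subgroup (𝒢.FundamentalGroup T)} (hV : ∀ u g, 𝒢.ofVertex T u g ∈ S)
    (hE : ∀ e, 𝒢.ofEdge T e ∈ S) : S = ⊤ := by
  rw [Subgroup.eq_top_iff']
  intro g
  obtain ⟨g, rfl⟩ := QuotientGroup.mk'_surjective _ g
  induction g using Monoid.Coprod.induction_on with
  | inl x =>
    induction x using Monoid.CoprodI.induction_on with
    | one => simp
    | of u g => exact hV u g
    | mul x y hx hy => rw [map_mul, map_mul]; exact mul_mem hx hy
  | inr x =>
    induction x using FreeGroup.induction_on with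
    | C1 => simp
    | of e => exact hE e
    | inv_of e h => rw [map_inv, map_inv]; exact inv_mem h
    | mul x y hx hy => rw [map_mul, map_mul]; exact mul_mem hx hy
  | mul x y hx hy => rw [map_mul]; exact mul_mem hx hy

theorem exists_lift {L : Type*} [Group L] (φ : ∀ u, 𝒢.vertexGroup u →* L) (s : E → L)
    (hs : ∀ e a, s e * φ _ (𝒢.toTerminus e a) = φ _ (𝒢.toOrigin e a) * s e)
    (hsT : ∀ e ∈ T, s e = 1) :
    ∃ Φ : 𝒢.FundamentalGroup T →* L, (∀ u g, Φ (𝒢.ofVertex T u g) = φ u g) ∧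
      ∀ e, Φ (𝒢.ofEdge T e) = s e := by
  let Ψ : 𝒢.FreeProd →* L := Monoid.Coprod.lift (Monoid.CoprodI.lift φ) (FreeGroup.lift s)
  have hV : ∀ u g, Ψ (𝒢.vertexIncl u g) = φ u g := fun u g => by simp [Ψ, vertexIncl]
  have hE : ∀ e, Ψ (𝒢.stableLetter e) = s e := fun e => by simp [Ψ, stableLetter]
  refine ⟨QuotientGroup.lift _ Ψ ?_, hV, hE⟩
  refine fun x hx => Subgroup.normalClosure_le_normal (N := Ψ.ker) ?_ hx
  rintro x (⟨e, a, rfl⟩ | ⟨e, he, rfl⟩)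
  · simp only [SetLike.mem_coe, MonoidHom.mem_ker, map_mul, map_inv, hV, hE, hs]
    group
  · simp only [SetLike.mem_coe, MonoidHom.mem_ker, hE, hsT e he]

/-- Any compatible family of homomorphisms extends to the fundamental group after conjugation. -/
theorem IsMaximalTree.exists_lift_conj [Finite V] [Finite E] (hT : 𝒢.IsMaximalTree T) {L : Type*}
    [Group L] (φ : ∀ u, 𝒢.vertexGroup u →* L) (s : E → L)
    (hs : ∀ e a, s e * φ _ (𝒢.toTerminus e a) = φ _ (𝒢.toOrigin e a) * s e) :
    ∃ (Φ : 𝒢.FundamentalGroup T →* L) (d : V → L), ∀ u g,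
      Φ (𝒢.ofVertex T u g) = (d u)⁻¹ * φ u g * d u := by
  obtain ⟨d, hd⟩ := hT.exists_integral s
  obtain ⟨Φ, hΦ, -⟩ := exists_lift (𝒢 := 𝒢) (T := T)
    (fun u => (MulAut.conj (d u)⁻¹).toMonoidHom.comp (φ u))
    (fun e => (d (𝒢.origin e))⁻¹ * s e * d (𝒢.terminus e)) (fun e a => by
      simp only [MonoidHom.comp_apply, MulEquiv.coe_toMonoidHom, MulAut.conj_apply, inv_inv]
      have := hs e a
      rw [← mul_inv_eq_iff_eq_mul] at this
      rw [← this]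
      group) (fun e he => by rw [hd e he]; group)
  exact ⟨Φ, d, fun u g => by simp [hΦ]⟩

/-- Finite quotients of the vertex groups that are faithful on the edge groups extend to a finite
quotient of the fundamental group. -/
theorem IsMaximalTree.exists_normal_finiteIndex [Finite V] [Finite E] (hT : 𝒢.IsMaximalTree T)
    [∀ e, Finite (𝒢.edgeGroup e)]
    (N : ∀ u, Subgroup (𝒢.vertexGroup u)) [∀ u, (N u).Normal] [∀ u, (N u).FiniteIndex]
    (hO : ∀ e a, 𝒢.toOrigin e a ∈ N _ → a = 1) (hE : ∀ e a, 𝒢.toTerminus e a ∈ N _ → a = 1) :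
    ∃ H : Subgroup (𝒢.FundamentalGroup T), H.Normal ∧ H.FiniteIndex ∧
      ∀ u, H.comap (𝒢.ofVertex T u) = N u := by
  classical
  -- One finite set serves all vertex groups: each acts by translation in its own coordinate, with
  -- kernel `N u`. An edge group acts freely through either end, so the two actions are isomorphic
  -- and the isomorphism can serve as stable letter.
  let Ω := ∀ u, 𝒢.vertexGroup u ⧸ N u
  let f : ∀ u, 𝒢.vertexGroup u →* Ω := fun u =>
    (MonoidHom.mulSingle (fun u => 𝒢.vertexGroup u ⧸ N u) u).comp (QuotientGroup.mk' (N u))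
  have hf : ∀ u g, f u g = 1 ↔ g ∈ N u := by
    intro u g
    rw [← QuotientGroup.eq_one_iff, ← Pi.mulSingle_eq_one_iff (i := u) (M := fun u => 𝒢.vertexGroup u ⧸ N u)]
    rfl
  let φ : ∀ u, 𝒢.vertexGroup u →* Equiv.Perm Ω := fun u => (MulAction.toPermHom Ω Ω).comp (f u)
  have hs : ∀ e, ∃ s : Equiv.Perm Ω, ∀ a,
      s * φ _ (𝒢.toTerminus e a) = φ _ (𝒢.toOrigin e a) * s := by
    intro e
    obtain ⟨s, hs⟩ := @exists_equivariant_equiv (𝒢.edgeGroup e) Ω Ω _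
      (MulAction.compHom Ω ((f _).comp (𝒢.toTerminus e)))
      (MulAction.compHom Ω ((f _).comp (𝒢.toOrigin e))) _ _ _
      (fun a x hx => hE e a ((hf _ _).1 (mul_eq_right.1 hx)))
      (fun a x hx => hO e a ((hf _ _).1 (mul_eq_right.1 hx))) rfl
    exact ⟨s, fun a => Equiv.ext fun x => hs a x⟩
  choose s hs using hs
  obtain ⟨Φ, d, hΦ⟩ := hT.exists_lift_conj φ s hs
  refine ⟨Φ.ker, inferInstance, Subgroup.finiteIndex_ker Φ, fun u => ?_⟩
  ext g
  rw [Subgroup.mem_comap, MonoidHom.mem_ker, hΦ, ← hf]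
  have h1 : (d u)⁻¹ * φ u g * d u = 1 ↔ φ u g = 1 := by
    rw [mul_assoc, inv_mul_eq_one, eq_comm, mul_eq_right]
  rw [h1]
  refine ⟨fun h => ?_, fun h => ?_⟩
  · simpa [φ] using DFunLike.congr_fun h (1 : Ω)
  · rw [MonoidHom.comp_apply, h, map_one]

end GraphOfGroups

/-! ### Covering graphs of groups and the upper bound for the rank of a stabilizer. -/

namespace GraphOfGroups

open MulAction

/-- A group generated by images of the vertex groups and by elements that satisfy the relations of
the stable letters relative to `T`. -/
structure Marking {V E : Type*} (𝒢 : GraphOfGroups V E) (T : Set E) (G : Type*) [Group G] where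
  /-- The homomorphisms from the vertex groups. -/
  vertex : ∀ u, 𝒢.vertexGroup u →* G
  /-- The images of the stable letters. -/
  edge : E → G
  edge_mul_vertex : ∀ e a, edge e * vertex _ (𝒢.toTerminus e a) = vertex _ (𝒢.toOrigin e a) * edge e
  edge_eq_one : ∀ e ∈ T, edge e = 1
  eq_top_of_mem : ∀ S : Subgroup G, (∀ u g, vertex u g ∈ S) → (∀ e, edge e ∈ S) → S = ⊤

/-- The canonical marking of the fundamental group. -/
def marking {V E : Type*} (𝒢 : GraphOfGroups V E) (T : Set E) :
    𝒢.Marking T (𝒢.FundamentalGroup T) where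
  vertex := 𝒢.ofVertex T
  edge := 𝒢.ofEdge T
  edge_mul_vertex := ofEdge_mul_ofVertex
  edge_eq_one _ := ofEdge_eq_one
  eq_top_of_mem _ := eq_top_of_mem

/-- The orbits of the vertex groups on a set, that is, the vertices of the covering graph of groups
determined by an action of the fundamental group. -/
abbrev VertexOrbits {V E : Type*} (𝒢 : GraphOfGroups V E) (X : Type*)
    [∀ u, MulAction (𝒢.vertexGroup u) X] :=
  Σ u, orbitRel.Quotient (𝒢.vertexGroup u) X

/-- The orbits of the edge groups on a set, that is, the edges of the covering graph of groups
determined by an action of the fundamental group. -/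
abbrev EdgeOrbits {V E : Type*} (𝒢 : GraphOfGroups V E) (X : Type*)
    [∀ e, MulAction (𝒢.edgeGroup e) X] :=
  Σ e, orbitRel.Quotient (𝒢.edgeGroup e) X

namespace Marking

variable {V E : Type*} {𝒢 : GraphOfGroups V E} {T : Set E} {G : Type*} [Group G]
  {X : Type*} [MulAction G X] [∀ u, MulAction (𝒢.vertexGroup u) X]
  [∀ e, MulAction (𝒢.edgeGroup e) X]

/-- The vertex and edge groups act on `X` through `G`, the edge groups via their termini. -/
structure IsCompatible (μ : 𝒢.Marking T G) (X : Type*) [MulAction G X]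
    [∀ u, MulAction (𝒢.vertexGroup u) X] [∀ e, MulAction (𝒢.edgeGroup e) X] : Prop where
  vertex_smul : ∀ u (g : 𝒢.vertexGroup u) (x : X), μ.vertex u g • x = g • x
  edgeGroup_smul : ∀ e (a : 𝒢.edgeGroup e) (x : X), a • x = 𝒢.toTerminus e a • x

theorem IsCompatible.edge_smul_smul {μ : 𝒢.Marking T G} (h : μ.IsCompatible X) (e : E)
    (a : 𝒢.edgeGroup e) (x : X) : μ.edge e • a • x = 𝒢.toOrigin e a • μ.edge e • x := by
  rw [h.edgeGroup_smul, ← h.vertex_smul, ← h.vertex_smul, ← mul_smul, ← mul_smul, μ.edge_mul_vertex]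

/-- The vertex orbit of a point. -/
abbrev _root_.GraphOfGroups.vertexOrbit (𝒢 : GraphOfGroups V E) {X : Type*}
    [∀ u, MulAction (𝒢.vertexGroup u) X] (u : V) (x : X) : 𝒢.VertexOrbits X :=
  ⟨u, orbitClass (𝒢.vertexGroup u) x⟩

/-- The origin of an edge orbit. -/
noncomputable def orbitOrigin (μ : 𝒢.Marking T G) (m : 𝒢.EdgeOrbits X) : 𝒢.VertexOrbits X :=
  𝒢.vertexOrbit (𝒢.origin m.1) (μ.edge m.1 • m.2.out)

/-- The terminus of an edge orbit. -/
noncomputable def orbitTerminus (_μ : 𝒢.Marking T G) (m : 𝒢.EdgeOrbits X) : 𝒢.VertexOrbits X :=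
  𝒢.vertexOrbit (𝒢.terminus m.1) m.2.out

/-- The covering graph determined by a transitive action is connected. -/
theorem IsCompatible.eq_univ_of_closed [IsPretransitive G X] {μ : 𝒢.Marking T G}
    (h : μ.IsCompatible X) (hT : 𝒢.IsMaximalTree T) (C : Set (𝒢.VertexOrbits X))
    (hC : ∀ m, μ.orbitOrigin m ∈ C ↔ μ.orbitTerminus m ∈ C) (hne : C.Nonempty) : C = Set.univ := by
  have hE : ∀ e (x : X), 𝒢.vertexOrbit (𝒢.origin e) (μ.edge e • x) ∈ C ↔
      𝒢.vertexOrbit (𝒢.terminus e) x ∈ C := by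
    intro e x
    obtain ⟨r, hr, -⟩ := exists_transporter (𝒢.edgeGroup e) X
    have h1 := hC ⟨e, orbitClass _ x⟩
    rw [← hr x, h.edge_smul_smul, h.edgeGroup_smul]
    simpa [orbitOrigin, orbitTerminus, vertexOrbit] using h1
  -- Stable letters of `T` act trivially, so each point of `X` carries a copy of the tree `T` in the
  -- covering graph.
  have hV : ∀ x u v, 𝒢.vertexOrbit u x ∈ C → 𝒢.vertexOrbit v x ∈ C := by
    intro x u v hu
    have h2 : {v | 𝒢.vertexOrbit v x ∈ C} = Set.univ :=
      hT.eq_univ_of_closed (fun e he => by simpa [μ.edge_eq_one e he] using hE e x) ⟨u, hu⟩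
    exact Set.eq_univ_iff_forall.1 h2 v
  have hG : ∀ g : G, ∀ u x, 𝒢.vertexOrbit u (g • x) ∈ C ↔ 𝒢.vertexOrbit u x ∈ C := by
    let S : Subgroup G :=
      { carrier := {g | ∀ u x, 𝒢.vertexOrbit u (g • x) ∈ C ↔ 𝒢.vertexOrbit u x ∈ C}
        one_mem' := fun u x => by rw [one_smul]
        mul_mem' := fun {g g'} hg hg' u x => by rw [mul_smul, hg, hg']
        inv_mem' := fun {g} hg u x => by rw [← hg, smul_inv_smul] }
    have hS : S = ⊤ := by
      refine μ.eq_top_of_mem S (fun v g u x => ?_) fun e u x => ?_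
      · have h3 : 𝒢.vertexOrbit v (μ.vertex v g • x) = 𝒢.vertexOrbit v x := by
          rw [h.vertex_smul, vertexOrbit, orbitClass_smul]
        exact ⟨fun h4 => hV _ v u (h3 ▸ hV _ u v h4), fun h4 => hV _ v u (h3.symm ▸ hV _ u v h4)⟩
      · exact ⟨fun h4 => hV _ _ u ((hE e x).1 (hV _ u _ h4)),
          fun h4 => hV _ _ u ((hE e x).2 (hV _ u _ h4))⟩
    exact fun g => (hS.symm ▸ Subgroup.mem_top g : g ∈ S)
  obtain ⟨p, hp⟩ := hne
  refine Set.eq_univ_of_forall fun q => ?_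
  obtain ⟨g, hg⟩ := exists_smul_eq G p.2.out q.2.out
  have hp' : 𝒢.vertexOrbit p.1 p.2.out = p := Sigma.ext rfl (heq_of_eq (orbitClass_out _))
  have hq' : 𝒢.vertexOrbit q.1 q.2.out = q := Sigma.ext rfl (heq_of_eq (orbitClass_out _))
  rw [← hq', ← hg]
  exact hV _ p.1 q.1 ((hG g _ _).2 (hp'.symm ▸ hp))

/-- The number of generators of a point stabilizer is at most the one computed from the covering
graph of groups. -/
theorem IsCompatible.rank_stabilizer_add_card_le [Finite V] [Finite E] [Finite X]
    [Fintype (𝒢.VertexOrbits X)] [IsPretransitive G X] {μ : 𝒢.Marking T G} (h : μ.IsCompatible X)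
    (hT : 𝒢.IsMaximalTree T) (x₀ : X) [Group.FG (stabilizer G x₀)]
    [∀ p : 𝒢.VertexOrbits X, Group.FG (stabilizer (𝒢.vertexGroup p.1) p.2.out)] :
    Group.rank (stabilizer G x₀) + Nat.card (𝒢.VertexOrbits X) ≤
      ∑ p : 𝒢.VertexOrbits X, Group.rank (stabilizer (𝒢.vertexGroup p.1) p.2.out) +
        Nat.card (𝒢.EdgeOrbits X) + 1 := by
  classical
  obtain ⟨u₀⟩ := hT.nonempty
  have : Nonempty (𝒢.VertexOrbits X) := ⟨𝒢.vertexOrbit u₀ x₀⟩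
  have : Fintype (𝒢.EdgeOrbits X) := Fintype.ofFinite _
  obtain ⟨S, hS, hint⟩ := exists_spanning μ.orbitOrigin μ.orbitTerminus (h.eq_univ_of_closed hT)
  choose r hr hr1 using fun u => exists_transporter (𝒢.vertexGroup u) X
  choose δ hδ using fun p : 𝒢.VertexOrbits X => exists_smul_eq G x₀ p.2.out
  let y : 𝒢.EdgeOrbits X → X := fun m => m.2.out
  let R : ∀ _ : V, X → G := fun u x => μ.vertex u (r u x)
  have hR : ∀ u x, R u x • (𝒢.vertexOrbit u x).2.out = x := fun u x =>
    (h.vertex_smul _ _ _).trans (hr u x)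
  have hR' : ∀ u x, (R u x)⁻¹ • x = (𝒢.vertexOrbit u x).2.out := fun u x =>
    inv_smul_eq_iff.2 (hR u x).symm
  -- The label of an edge orbit carries the base point of its terminus to that of its origin.
  let σ : 𝒢.EdgeOrbits X → G := fun m =>
    (R (𝒢.origin m.1) (μ.edge m.1 • y m))⁻¹ * μ.edge m.1 * R (𝒢.terminus m.1) (y m)
  have hσ : ∀ m, σ m • (μ.orbitTerminus m).2.out = (μ.orbitOrigin m).2.out := by
    intro m
    simp only [σ, mul_smul]
    rw [orbitTerminus, hR, hR']
    rfl
  have hσ' : ∀ m, (δ (μ.orbitOrigin m))⁻¹ * σ m * δ (μ.orbitTerminus m) ∈ stabilizer G x₀ := by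
    intro m
    rw [mem_stabilizer_iff, mul_smul, mul_smul, hδ, hσ, inv_smul_eq_iff, hδ]
  -- Integrating inside the stabilizer corrects `δ` to a `d` that still carries `x₀` to the base
  -- points and for which the edges of `S` contribute trivial generators.
  obtain ⟨d', hd'⟩ := hint (stabilizer G x₀) fun m => ⟨_, hσ' m⟩
  let d : 𝒢.VertexOrbits X → G := fun p => δ p * d' p
  have hd : ∀ p, d p • x₀ = p.2.out := by
    intro p
    rw [mul_smul, mem_stabilizer_iff.1 (d' p).2, hδ]
  have hdS : ∀ m ∈ S, d (μ.orbitOrigin m) = σ m * d (μ.orbitTerminus m) := by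
    intro m hm
    simp only [d, hd' m hm, Subgroup.coe_mul]
    group
  have hloop : ∀ (p : 𝒢.VertexOrbits X) (a : stabilizer (𝒢.vertexGroup p.1) p.2.out),
      (d p)⁻¹ * μ.vertex p.1 a * d p ∈ stabilizer G x₀ := by
    intro p a
    rw [mem_stabilizer_iff, mul_smul, mul_smul, hd, h.vertex_smul, mem_stabilizer_iff.1 a.2,
      inv_smul_eq_iff, hd]
  have hτ : ∀ m, (d (μ.orbitOrigin m))⁻¹ * σ m * d (μ.orbitTerminus m) ∈ stabilizer G x₀ := by
    intro m
    rw [mem_stabilizer_iff, mul_smul, mul_smul, hd, hσ, inv_smul_eq_iff, hd]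
  choose B hB hB' using fun p : 𝒢.VertexOrbits X =>
    Group.rank_spec (stabilizer (𝒢.vertexGroup p.1) p.2.out)
  let L : Finset (stabilizer G x₀) :=
    Finset.univ.biUnion (fun p => (B p).image fun a => ⟨_, hloop p a⟩) ∪
      (Finset.univ \ S).image fun m => ⟨_, hτ m⟩
  have hLcard : L.card + S.card ≤
      ∑ p : 𝒢.VertexOrbits X, Group.rank (stabilizer (𝒢.vertexGroup p.1) p.2.out) +
        Nat.card (𝒢.EdgeOrbits X) := by
    have h1 : (Finset.univ.biUnion (fun p => (B p).image fun a =>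
        (⟨_, hloop p a⟩ : stabilizer G x₀))).card ≤
        ∑ p : 𝒢.VertexOrbits X, Group.rank (stabilizer (𝒢.vertexGroup p.1) p.2.out) :=
      Finset.card_biUnion_le.trans (Finset.sum_le_sum fun p _ => hB p ▸ Finset.card_image_le)
    have h2 : ((Finset.univ \ S).image fun m => (⟨_, hτ m⟩ : stabilizer G x₀)).card + S.card ≤
        Nat.card (𝒢.EdgeOrbits X) := by
      rw [Nat.card_eq_fintype_card, ← Finset.card_univ,
        ← Finset.card_sdiff_add_card_eq_card (Finset.subset_univ S)]
      exact Nat.add_le_add_right Finset.card_image_le _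
    have h3 := Finset.card_union_le (Finset.univ.biUnion (fun p => (B p).image fun a =>
        (⟨_, hloop p a⟩ : stabilizer G x₀)))
      ((Finset.univ \ S).image fun m => (⟨_, hτ m⟩ : stabilizer G x₀))
    simp only [L]
    omega
  suffices hL : Subgroup.closure (L : Set (stabilizer G x₀)) = ⊤ by
    have := Group.rank_le hL
    omega
  let K : Subgroup G := (Subgroup.closure (L : Set (stabilizer G x₀))).map (Subgroup.subtype _)
  suffices hK : stabilizer G x₀ ≤ K by
    rw [Subgroup.eq_top_iff']
    intro g
    obtain ⟨g', hg', hgg⟩ := hK g.2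
    rwa [← Subtype.ext hgg]
  have hloopK : ∀ (p : 𝒢.VertexOrbits X) (a : stabilizer (𝒢.vertexGroup p.1) p.2.out),
      (d p)⁻¹ * μ.vertex p.1 a * d p ∈ K := by
    intro p a
    have ha : a ∈ Subgroup.closure (B p : Set (stabilizer (𝒢.vertexGroup p.1) p.2.out)) :=
      hB' p ▸ Subgroup.mem_top a
    induction ha using Subgroup.closure_induction with
    | mem a ha =>
      refine ⟨⟨_, hloop p a⟩, Subgroup.subset_closure ?_, rfl⟩
      exact Finset.mem_coe.2 (Finset.mem_union_left _ (Finset.mem_biUnion.2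
        ⟨p, Finset.mem_univ p, Finset.mem_image_of_mem _ ha⟩))
    | one => simp
    | mul a b _ _ ha hb =>
      convert mul_mem ha hb using 1
      rw [Subgroup.coe_mul, map_mul]
      group
    | inv a _ ha =>
      convert inv_mem ha using 1
      rw [Subgroup.coe_inv, map_inv]
      group
  have hτK : ∀ m, (d (μ.orbitOrigin m))⁻¹ * σ m * d (μ.orbitTerminus m) ∈ K := by
    intro m
    by_cases hm : m ∈ S
    · rw [hdS m hm]
      simp
    · refine ⟨⟨_, hτ m⟩, Subgroup.subset_closure ?_, rfl⟩
      exact Finset.mem_coe.2 (Finset.mem_union_right _ (Finset.mem_image_of_mem _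
        (Finset.mem_sdiff.2 ⟨Finset.mem_univ m, hm⟩)))
  -- For each `u` a transversal with `D u x • x₀ = x`. It remains to see that `K` contains the
  -- Schreier elements of all generators of `G`, and that changing `u` only changes `D u x` by `K`.
  let D : V → X → G := fun u x => R u x * d (𝒢.vertexOrbit u x)
  have hD : ∀ u x, D u x • x₀ = x := by
    intro u x
    rw [mul_smul, hd, hR]
  have hDV : ∀ u (g : 𝒢.vertexGroup u) x, (D u (g • x))⁻¹ * μ.vertex u g * D u x ∈ K := by
    intro u g x
    have h1 : 𝒢.vertexOrbit u (g • x) = 𝒢.vertexOrbit u x := by rw [vertexOrbit, orbitClass_smul]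
    have h2 : (r u (g • x))⁻¹ * g * r u x ∈
        stabilizer (𝒢.vertexGroup u) (𝒢.vertexOrbit u x).2.out := by
      rw [mem_stabilizer_iff, mul_smul, mul_smul, hr, inv_smul_eq_iff, ← h1, hr]
    convert hloopK (𝒢.vertexOrbit u x) ⟨_, h2⟩ using 1
    simp only [D, R, h1, map_mul, map_inv]
    group
  have hDE' : ∀ m : 𝒢.EdgeOrbits X, (D (𝒢.origin m.1) (μ.edge m.1 • y m))⁻¹ * μ.edge m.1 *
      D (𝒢.terminus m.1) (y m) ∈ K := by
    intro m
    convert hτK m using 1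
    simp only [D, σ, orbitOrigin, orbitTerminus, y]
    group
  have hDE : ∀ e x, (D (𝒢.origin e) (μ.edge e • x))⁻¹ * μ.edge e * D (𝒢.terminus e) x ∈ K := by
    intro e x
    obtain ⟨ρ, hρ, -⟩ := exists_transporter (𝒢.edgeGroup e) X
    have h1 := hDE' ⟨e, orbitClass (𝒢.edgeGroup e) x⟩
    have h2 := hDV (𝒢.origin e) (𝒢.toOrigin e (ρ x)) (μ.edge e • (orbitClass (𝒢.edgeGroup e) x).out)
    have h3 := hDV (𝒢.terminus e) (𝒢.toTerminus e (ρ x)) (orbitClass (𝒢.edgeGroup e) x).out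
    rw [← h.edge_smul_smul, hρ] at h2
    rw [← h.edgeGroup_smul, hρ] at h3
    convert mul_mem (mul_mem h2 h1) (inv_mem h3) using 1
    have h4 := μ.edge_mul_vertex e (ρ x)
    rw [← mul_inv_eq_iff_eq_mul.2 h4]
    simp only [y]
    group
  have hDT : ∀ x u v, (D u x)⁻¹ * D v x ∈ K := by
    intro x u v
    have h1 : {v | (D u x)⁻¹ * D v x ∈ K} = Set.univ := by
      refine hT.eq_univ_of_closed (fun e he => ?_) ⟨u, by simp⟩
      have h2 := hDE e x
      rw [μ.edge_eq_one e he, one_smul, mul_one] at h2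
      simp only [Set.mem_ofPred_eq]
      constructor
      · intro h3
        convert mul_mem h3 h2 using 1
        group
      · intro h3
        convert mul_mem h3 (inv_mem h2) using 1
        group
    exact Set.eq_univ_iff_forall.1 h1 v
  have hDG : ∀ g x, (D u₀ (g • x))⁻¹ * g * D u₀ x ∈ K := by
    let Q : Subgroup G :=
      { carrier := {g | ∀ x, (D u₀ (g • x))⁻¹ * g * D u₀ x ∈ K}
        one_mem' := fun x => by simp
        mul_mem' := fun {g g'} hg hg' x => by
          convert mul_mem (hg (g' • x)) (hg' x) using 1
          rw [mul_smul]
          group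
        inv_mem' := fun {g} hg x => by
          convert inv_mem (hg (g⁻¹ • x)) using 1
          rw [smul_inv_smul]
          group }
    have hQ : Q = ⊤ := by
      refine μ.eq_top_of_mem Q (fun u g x => ?_) fun e x => ?_
      · have h1 := hDV u g x
        rw [← h.vertex_smul] at h1
        convert mul_mem (mul_mem (hDT (μ.vertex u g • x) u₀ u) h1) (hDT x u u₀) using 1
        group
      · convert mul_mem (mul_mem (hDT (μ.edge e • x) u₀ (𝒢.origin e)) (hDE e x))
          (hDT x (𝒢.terminus e) u₀) using 1
        group
    exact fun g => (hQ.symm ▸ Subgroup.mem_top g : g ∈ Q)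
  intro g hg
  -- The conjugation is chosen so that the Schreier element of the conjugate at `x₀` is `g` itself.
  have h1 := hDG (D u₀ x₀ * g * (D u₀ x₀)⁻¹) x₀
  have h2 : (D u₀ x₀ * g * (D u₀ x₀)⁻¹) • x₀ = x₀ := by
    rw [mul_smul, mul_smul, inv_smul_eq_iff.2 (hD u₀ x₀).symm, mem_stabilizer_iff.1 hg, hD]
  rw [h2] at h1
  convert h1 using 1
  group

end Marking

end GraphOfGroups

/-! ### Index sums and Schreier's inequality. -/

section Orbits

open MulAction

theorem sum_index_stabilizer_out (Γ X : Type*) [Group Γ] [MulAction Γ X] [Finite X]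
    [Fintype (orbitRel.Quotient Γ X)] :
    ∑ o : orbitRel.Quotient Γ X, (stabilizer Γ o.out).index = Nat.card X := by
  have h := Nat.card_congr (selfEquivSigmaOrbits Γ X)
  rw [h, Nat.card_sigma]
  exact Finset.sum_congr rfl fun o _ => (index_stabilizer Γ _).trans (Nat.card_coe_set_eq _).symm

end Orbits

namespace GraphOfGroups

/-- The graph of trivial groups with one vertex. -/
def bouquet (E : Type*) : GraphOfGroups Unit E where
  origin _ := ()
  terminus _ := ()
  vertexGroup _ := Unit
  edgeGroup _ := Unit
  toOrigin _ := 1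
  toOrigin_injective _ _ _ _ := rfl
  toTerminus _ := 1
  toTerminus_injective _ _ _ _ := rfl

theorem bouquet_isMaximalTree (E : Type*) : (bouquet E).IsMaximalTree ∅ where
  not_loop e he := he.elim
  not_parallel e he := he.elim
  isTree := by
    refine ⟨⟨fun u v => ?_⟩, fun v c hc => ?_⟩
    · rw [Subsingleton.elim u v]
    · cases c with
      | nil => exact hc.ne_nil rfl
      | cons h p => exact (h.ne (Subsingleton.elim _ _)).elim

/-- A generating set of a group, as a marking by the graph of trivial groups with one vertex. -/
def bouquetMarking {G : Type*} [Group G] (S : Set G) (hS : Subgroup.closure S = ⊤) :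
    (bouquet S).Marking ∅ G where
  vertex _ := 1
  edge := Subtype.val
  edge_mul_vertex _ _ := by simp
  edge_eq_one _ he := he.elim
  eq_top_of_mem K _ hK := top_le_iff.1 (hS ▸ (Subgroup.closure_le K).2 fun s hs => hK ⟨s, hs⟩)

end GraphOfGroups

open MulAction GraphOfGroups in
/-- **Schreier's index inequality**. -/
theorem Subgroup.rank_add_index_le {G : Type*} [Group G] [Group.FG G] (K : Subgroup G)
    [K.FiniteIndex] : Group.rank K + K.index ≤ K.index * Group.rank G + 1 := by
  classical
  obtain ⟨S, hS, hS'⟩ := Group.rank_spec G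
  -- The cover of the bouquet has `K.index` vertices, all with trivial groups, and `K.index *
  -- Group.rank G` edges.
  let 𝒢 := bouquet (S : Set G)
  let X := G ⧸ K
  let μ := bouquetMarking (S : Set G) hS'
  let : ∀ u, MulAction (𝒢.vertexGroup u) X := fun u => MulAction.compHom X (1 : Unit →* G)
  let : ∀ e, MulAction (𝒢.edgeGroup e) X := fun e => MulAction.compHom X (1 : Unit →* G)
  have hμ : μ.IsCompatible X := ⟨fun _ _ _ => rfl, fun _ _ _ => rfl⟩
  have : Finite X := inferInstance
  have : Finite (S : Set G) := inferInstance
  let : Fintype (𝒢.VertexOrbits X) := Fintype.ofFinite _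
  have hstab : stabilizer G ((1 : G) : X) = K := stabilizer_quotient K
  have : Group.FG (stabilizer G ((1 : G) : X)) := hstab.symm ▸ inferInstance
  have hsub : ∀ u, Subsingleton (𝒢.vertexGroup u) := fun u => inferInstanceAs (Subsingleton Unit)
  have hsub' : ∀ u, Subsingleton (𝒢.edgeGroup u) := fun u => inferInstanceAs (Subsingleton Unit)
  have h := hμ.rank_stabilizer_add_card_le (bouquet_isMaximalTree _) ((1 : G) : X)
  have hV : Nat.card (𝒢.VertexOrbits X) = K.index := by
    have h1 : ∀ u, Nat.card (orbitRel.Quotient (𝒢.vertexGroup u) X) = K.index := by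
      intro u
      have := card_orbits_mul_card (Γ := 𝒢.vertexGroup u) (X := X) fun a x _ => Subsingleton.elim _ _
      rwa [(Nat.card_unique : Nat.card (𝒢.vertexGroup u) = 1), mul_one] at this
    rw [Nat.card_sigma]
    simp [h1]
  have hE : Nat.card (𝒢.EdgeOrbits X) = K.index * Group.rank G := by
    have h1 : ∀ e, Nat.card (orbitRel.Quotient (𝒢.edgeGroup e) X) = K.index := by
      intro e
      have := card_orbits_mul_card (Γ := 𝒢.edgeGroup e) (X := X) fun a x _ => Subsingleton.elim _ _
      rwa [(Nat.card_unique : Nat.card (𝒢.edgeGroup e) = 1), mul_one] at this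
    rw [Nat.card_sigma]
    simp [h1, hS, mul_comm]
  rw [Subgroup.rank_congr hstab, hV, hE, Finset.sum_eq_zero fun p _ => ?_, zero_add] at h
  · exact h
  · have := hsub p.1
    exact Group.rank_eq_zero _

/-! ### Cocycles and the lower bound for the rank of a stabilizer. -/

section Cocycles

open MulAction

/-- A cocycle on a set with a group action, with values in a group. -/
def IsCocycle {Γ X K : Type*} [Group Γ] [MulAction Γ X] [Group K] (c : Γ → X → K) : Prop :=
  ∀ g g' x, c (g * g') x = c g (g' • x) * c g' x

variable {Γ X K : Type*} [Group Γ] [MulAction Γ X] [Group K]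

theorem IsCocycle.one {c : Γ → X → K} (hc : IsCocycle c) (x : X) : c 1 x = 1 := by
  have := hc 1 1 x
  rwa [one_mul, one_smul, left_eq_mul] at this

theorem IsCocycle.inv {c : Γ → X → K} (hc : IsCocycle c) (g : Γ) (x : X) :
    c g⁻¹ (g • x) = (c g x)⁻¹ := by
  rw [eq_inv_iff_mul_eq_one, ← hc, inv_mul_cancel, hc.one]

/-- Homomorphisms on the stabilizers of the base points extend to a cocycle. -/
theorem exists_cocycle (f : ∀ o : orbitRel.Quotient Γ X, stabilizer Γ o.out →* K) :
    ∃ (c : Γ → X → K) (r : X → Γ), IsCocycle c ∧ (∀ x, r x • (orbitClass Γ x).out = x) ∧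
      (∀ x, c (r x) (orbitClass Γ x).out = 1) ∧ ∀ o (a : stabilizer Γ o.out), c a o.out = f o a := by
  classical
  obtain ⟨r, hr, hr1⟩ := exists_transporter Γ X
  -- Extension by `1` avoids carrying membership proofs; by `hmem` the cocycle only evaluates `κ` on
  -- the stabilizer.
  let κ : orbitRel.Quotient Γ X → Γ → K := fun o a =>
    if h : a ∈ stabilizer Γ o.out then f o ⟨a, h⟩ else 1
  have hκ : ∀ o a (h : a ∈ stabilizer Γ o.out), κ o a = f o ⟨a, h⟩ := fun o a h => dif_pos h
  have hκ1 : ∀ o, κ o 1 = 1 := fun o => by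
    rw [hκ o 1 (one_mem _)]
    exact map_one _
  have hmem : ∀ g x, (r (g • x))⁻¹ * g * r x ∈ stabilizer Γ (orbitClass Γ x).out := by
    intro g x
    have := hr (g • x)
    rw [orbitClass_smul] at this
    rw [mem_stabilizer_iff, mul_smul, mul_smul, hr, inv_smul_eq_iff, this]
  refine ⟨fun g x => κ (orbitClass Γ x) ((r (g • x))⁻¹ * g * r x), r, ?_, hr, ?_, ?_⟩
  · intro g g' x
    have h1 := hmem g (g' • x)
    rw [orbitClass_smul] at h1
    simp only [orbitClass_smul]
    rw [hκ _ _ (hmem (g * g') x), hκ _ _ h1, hκ _ _ (hmem g' x), ← map_mul]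
    congr 1
    ext
    simp only [Subgroup.coe_mul, mul_smul]
    group
  · intro x
    simp only [hr, orbitClass_out, hr1, inv_mul_cancel, mul_one, hκ1]
  · intro o a
    simp only [orbitClass_out, mem_stabilizer_iff.1 a.2, hr1, inv_one, one_mul, mul_one]
    exact hκ o a a.2

/-- Two cocycles of a free action are cohomologous, with prescribed values at the base points. -/
theorem exists_intertwiner (hfree : ∀ (a : Γ) (x : X), a • x = x → a = 1) {C D : Γ → X → K}
    (hC : IsCocycle C) (hD : IsCocycle D) (s : orbitRel.Quotient Γ X → K) :
    ∃ τ : X → K, (∀ a x, τ (a • x) * D a x = C a x * τ x) ∧ ∀ o, τ o.out = s o := by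
  obtain ⟨r, hr, hr1⟩ := exists_transporter Γ X
  refine ⟨fun x => C (r x) (orbitClass Γ x).out * s (orbitClass Γ x) *
    (D (r x) (orbitClass Γ x).out)⁻¹, fun a x => ?_, fun o => ?_⟩
  · simp only [orbitClass_smul, transporter_smul hfree hr, hC _ _ _, hD _ _ _, hr]
    group
  · simp only [orbitClass_out, hr1, hC.one, hD.one]
    group

end Cocycles

namespace GraphOfGroups

open MulAction

variable {V E : Type*} {𝒢 : GraphOfGroups V E} {T : Set E}

/-- A compatible family of cocycles of the vertex groups extends, after conjugation, to a cocycle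
of the fundamental group. -/
theorem IsMaximalTree.exists_cocycle [Finite V] [Finite E] (hT : 𝒢.IsMaximalTree T)
    {X K : Type*} [Group K] [MulAction (𝒢.FundamentalGroup T) X]
    [∀ u, MulAction (𝒢.vertexGroup u) X] [∀ e, MulAction (𝒢.edgeGroup e) X]
    (h : (𝒢.marking T).IsCompatible X) {γ : ∀ u, 𝒢.vertexGroup u → X → K}
    (hγ : ∀ u, IsCocycle (γ u)) {τ : E → X → K}
    (hτ : ∀ e a x, τ e (a • x) * γ _ (𝒢.toTerminus e a) x =
      γ _ (𝒢.toOrigin e a) (𝒢.ofEdge T e • x) * τ e x) :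
    ∃ (c : 𝒢.FundamentalGroup T → X → K) (d : V → X → K), IsCocycle c ∧
      (∀ u g x, c (𝒢.ofVertex T u g) x = (d u (g • x))⁻¹ * γ u g x * d u x) ∧
      ∀ e x, c (𝒢.ofEdge T e) x =
        (d (𝒢.origin e) (𝒢.ofEdge T e • x))⁻¹ * τ e x * d (𝒢.terminus e) x := by
  obtain ⟨d, hd⟩ := hT.exists_integral τ
  have hvs : ∀ u (g : 𝒢.vertexGroup u) (x : X), 𝒢.ofVertex T u g • x = g • x := h.vertex_smul
  have hvs' : ∀ u (g : 𝒢.vertexGroup u) (x : X), (𝒢.ofVertex T u g)⁻¹ • x = g⁻¹ • x := by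
    intro u g x
    rw [← map_inv, hvs]
  have hes : ∀ e (a : 𝒢.edgeGroup e) (x : X),
      𝒢.ofEdge T e • a • x = 𝒢.toOrigin e a • 𝒢.ofEdge T e • x := h.edge_smul_smul
  -- A cocycle is a homomorphism to `(X → K) ⋊ G` that is the identity on the second factor, so the
  -- universal property applies. The correction by `d`, integrated in the group `X → K`, makes the
  -- images of the stable letters of `T` trivial.
  let ψ : 𝒢.FundamentalGroup T →* MulAut (X → K) := mulAutArrow
  have hψ : ∀ g f (y : X), ψ g f y = f (g⁻¹ • y) := fun g f y => rfl
  let φ : ∀ u, 𝒢.vertexGroup u →* (X → K) ⋊[ψ] 𝒢.FundamentalGroup T := fun u =>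
    MonoidHom.mk' (fun g => ⟨fun y => (d u y)⁻¹ * γ u g (g⁻¹ • y) * d u (g⁻¹ • y),
      𝒢.ofVertex T u g⟩) fun g g' => by
        ext1
        · funext y
          simp only [SemidirectProduct.mul_left, Pi.mul_apply, hψ, hvs', hγ u _ _ _, mul_inv_rev,
            mul_smul, smul_inv_smul]
          group
        · simp
  let s : E → (X → K) ⋊[ψ] 𝒢.FundamentalGroup T := fun e =>
    ⟨fun y => (d (𝒢.origin e) y)⁻¹ * τ e ((𝒢.ofEdge T e)⁻¹ • y) *
      d (𝒢.terminus e) ((𝒢.ofEdge T e)⁻¹ • y), 𝒢.ofEdge T e⟩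
  obtain ⟨Φ, hΦV, hΦE⟩ := exists_lift (T := T) φ s (fun e a => by
    ext1
    · funext y
      obtain ⟨x, rfl⟩ : ∃ x, 𝒢.ofEdge T e • a • x = y :=
        ⟨a⁻¹ • (𝒢.ofEdge T e)⁻¹ • y, by rw [smul_inv_smul, smul_inv_smul]⟩
      simp only [SemidirectProduct.mul_left, Pi.mul_apply, hψ, φ, s, MonoidHom.mk'_apply, hvs',
        inv_smul_smul]
      rw [hes, inv_smul_smul, inv_smul_smul, h.edgeGroup_smul, inv_smul_smul,
        ← h.edgeGroup_smul, mul_assoc, mul_assoc, mul_assoc, mul_inv_cancel_left]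
      rw [← mul_assoc (τ e (a • x)), hτ]
      group
    · exact ofEdge_mul_ofVertex e a) (fun e he => by
    ext1
    · funext y
      have : d (𝒢.origin e) y = τ e y * d (𝒢.terminus e) y := congrFun (hd e he) y
      simp only [s, ofEdge_eq_one he, inv_one, one_smul, this, SemidirectProduct.one_left,
        Pi.one_apply]
      group
    · exact ofEdge_eq_one he)
  have hright : ∀ g, (Φ g).right = g := by
    have h1 : (SemidirectProduct.rightHom.comp Φ).eqLocus (MonoidHom.id _) = ⊤ :=
      eq_top_of_mem (fun u g => congrArg SemidirectProduct.right (hΦV u g))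
        fun e => congrArg SemidirectProduct.right (hΦE e)
    exact fun g => (h1.symm ▸ Subgroup.mem_top g :
      g ∈ (SemidirectProduct.rightHom.comp Φ).eqLocus (MonoidHom.id _))
  refine ⟨fun g x => (Φ g).left (g • x), d, fun g g' x => ?_, fun u g x => ?_, fun e x => ?_⟩
  · simp only [map_mul, SemidirectProduct.mul_left, Pi.mul_apply, hψ, hright, mul_smul,
      inv_smul_smul]
  · simp only [hΦV, φ, MonoidHom.mk'_apply, hvs, inv_smul_smul]
  · simp only [hΦE, s, inv_smul_smul]

/-- The stabilizers of the base points of the vertex orbits. -/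
abbrev OrbitStabilizer (𝒢 : GraphOfGroups V E) (X : Type*) [∀ u, MulAction (𝒢.vertexGroup u) X]
    (p : 𝒢.VertexOrbits X) : Type _ :=
  stabilizer (𝒢.vertexGroup p.1) p.2.out

/-- The free product of the stabilizers of the base points of the vertex orbits and of the free group
on the edge orbits. -/
abbrev OrbitFreeProd (𝒢 : GraphOfGroups V E) (X : Type*) [∀ u, MulAction (𝒢.vertexGroup u) X]
    [∀ e, MulAction (𝒢.edgeGroup e) X] :=
  Monoid.Coprod (Monoid.CoprodI (𝒢.OrbitStabilizer X)) (FreeGroup (𝒢.EdgeOrbits X))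

open Monoid in
/-- If the edge groups act freely, the number of generators of a point stabilizer is at least the one
computed from the covering graph of groups. -/
theorem IsMaximalTree.card_le_rank_stabilizer_add_card [Finite V] [Finite E]
    (hT : 𝒢.IsMaximalTree T) {X : Type*} [Finite X] [MulAction (𝒢.FundamentalGroup T) X]
    [IsPretransitive (𝒢.FundamentalGroup T) X]
    [∀ u, MulAction (𝒢.vertexGroup u) X] [∀ e, MulAction (𝒢.edgeGroup e) X]
    [Fintype (𝒢.VertexOrbits X)] (h : (𝒢.marking T).IsCompatible X)
    (hfree : ∀ e (a : 𝒢.edgeGroup e) (x : X), a • x = x → a = 1) (x₀ : X)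
    [Group.FG (stabilizer (𝒢.FundamentalGroup T) x₀)]
    [∀ p : 𝒢.VertexOrbits X, Group.FG (stabilizer (𝒢.vertexGroup p.1) p.2.out)] :
    ∑ p : 𝒢.VertexOrbits X, Group.rank (stabilizer (𝒢.vertexGroup p.1) p.2.out) +
        Nat.card (𝒢.EdgeOrbits X) + 1 ≤
      Group.rank (stabilizer (𝒢.FundamentalGroup T) x₀) + Nat.card (𝒢.VertexOrbits X) := by
  classical
  have hvs : ∀ u (g : 𝒢.vertexGroup u) (x : X), 𝒢.ofVertex T u g • x = g • x := h.vertex_smul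
  have hes : ∀ e (a : 𝒢.edgeGroup e) (x : X),
      𝒢.ofEdge T e • a • x = 𝒢.toOrigin e a • 𝒢.ofEdge T e • x := h.edge_smul_smul
  -- At base points, the cocycles `γ` are the inclusions of the stabilizers into the free product,
  -- and the intertwiners `τ` take the free generators as values.
  choose γ r hγ hr hγr hγA using fun u => _root_.exists_cocycle (Γ := 𝒢.vertexGroup u) (X := X)
    (K := 𝒢.OrbitFreeProd X) fun o => Coprod.inl.comp (CoprodI.of (M := 𝒢.OrbitStabilizer X) (i := ⟨u, o⟩))
  choose τ hτ hτs using fun e => exists_intertwiner (Γ := 𝒢.edgeGroup e) (X := X) (K := 𝒢.OrbitFreeProd X) (hfree e)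
    (C := fun a x => γ _ (𝒢.toOrigin e a) (𝒢.ofEdge T e • x))
    (D := fun a x => γ _ (𝒢.toTerminus e a) x)
    (fun a b x => by simp only [map_mul, hγ _ _ _, hes])
    (fun a b x => by simp only [map_mul, hγ _ _ _, h.edgeGroup_smul])
    fun o => Coprod.inr (FreeGroup.of ⟨e, o⟩)
  obtain ⟨c, d, hc, hcV, hcE⟩ := hT.exists_cocycle h hγ hτ
  choose g hg using fun p : 𝒢.VertexOrbits X => exists_smul_eq (𝒢.FundamentalGroup T) x₀ p.2.out
  obtain ⟨u₀⟩ := hT.nonempty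
  let p₀ : 𝒢.VertexOrbits X := 𝒢.vertexOrbit u₀ x₀
  let δ : 𝒢.VertexOrbits X → 𝒢.OrbitFreeProd X := fun p => d p.1 p.2.out * c (g p) x₀
  obtain ⟨S, hS, hS'⟩ := Group.rank_spec (stabilizer (𝒢.FundamentalGroup T) x₀)
  -- Generators of the stabilizer give one element each, and every vertex orbit other than `p₀`
  -- gives one element that compares it with `p₀`.
  let B : Finset (𝒢.OrbitFreeProd X) := (S.image fun k : stabilizer (𝒢.FundamentalGroup T) x₀ => δ p₀ * c (k : 𝒢.FundamentalGroup T) x₀ * (δ p₀)⁻¹) ∪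
    (Finset.univ.erase p₀).image fun p => δ p * (δ p₀)⁻¹
  have hB : B.card + 1 ≤ Group.rank (stabilizer (𝒢.FundamentalGroup T) x₀) + Nat.card (𝒢.VertexOrbits X) := by
    have h1 : (S.image fun k : stabilizer (𝒢.FundamentalGroup T) x₀ => δ p₀ * c (k : 𝒢.FundamentalGroup T) x₀ * (δ p₀)⁻¹).card ≤ S.card := Finset.card_image_le
    have h2 : ((Finset.univ.erase p₀).image fun p => δ p * (δ p₀)⁻¹).card ≤
        (Finset.univ.erase p₀).card := Finset.card_image_le
    have h3 := Finset.card_erase_add_one (Finset.mem_univ p₀)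
    have h4 := Finset.card_union_le (S.image fun k : stabilizer (𝒢.FundamentalGroup T) x₀ => δ p₀ * c (k : 𝒢.FundamentalGroup T) x₀ * (δ p₀)⁻¹)
      ((Finset.univ.erase p₀).image fun p => δ p * (δ p₀)⁻¹)
    rw [Finset.card_univ, ← Nat.card_eq_fintype_card] at h3
    simp only [B]
    omega
  have hbound : ∑ p : 𝒢.VertexOrbits X, Group.rank (stabilizer (𝒢.vertexGroup p.1) p.2.out) +
      Nat.card (𝒢.EdgeOrbits X) ≤ Group.rank (𝒢.OrbitFreeProd X) :=
    Group.sum_rank_add_card_le_rank (M := 𝒢.EdgeOrbits X) (𝒢.OrbitStabilizer X)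
  suffices hL : Subgroup.closure (B : Set (𝒢.OrbitFreeProd X)) = ⊤ by
    have := Group.rank_le hL
    omega
  set L := Subgroup.closure (B : Set (𝒢.OrbitFreeProd X))
  have hδ₀ : ∀ p, δ p * (δ p₀)⁻¹ ∈ L := by
    intro p
    by_cases hp : p = p₀
    · rw [hp, mul_inv_cancel]
      exact one_mem _
    · exact Subgroup.subset_closure (Finset.mem_coe.2 (Finset.mem_union_right _
        (Finset.mem_image_of_mem (fun p => δ p * (δ p₀)⁻¹)
          (Finset.mem_erase.2 ⟨hp, Finset.mem_univ p⟩))))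
  have hstab₀ : ∀ k : stabilizer (𝒢.FundamentalGroup T) x₀, δ p₀ * c (k : 𝒢.FundamentalGroup T) x₀ * (δ p₀)⁻¹ ∈ L := by
    intro k
    have hk : k ∈ Subgroup.closure (S : Set (stabilizer (𝒢.FundamentalGroup T) x₀)) := hS' ▸ Subgroup.mem_top k
    induction hk using Subgroup.closure_induction with
    | mem k hk =>
      exact Subgroup.subset_closure (Finset.mem_coe.2 (Finset.mem_union_left _
        (Finset.mem_image_of_mem (fun k : stabilizer (𝒢.FundamentalGroup T) x₀ => δ p₀ * c (k : 𝒢.FundamentalGroup T) x₀ * (δ p₀)⁻¹) hk)))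
    | one =>
      rw [Subgroup.coe_one, hc.one, mul_one, mul_inv_cancel]
      exact one_mem _
    | mul a b _ _ ha hb =>
      convert mul_mem ha hb using 1
      rw [Subgroup.coe_mul, hc, mem_stabilizer_iff.1 b.2]
      group
    | inv a _ ha =>
      convert inv_mem ha using 1
      have := hc.inv (a : 𝒢.FundamentalGroup T) x₀
      rw [mem_stabilizer_iff.1 a.2] at this
      rw [Subgroup.coe_inv, this]
      group
  -- Any `a` from base point to base point factors as `g p * k * (g q)⁻¹` with `k` in the stabilizer
  -- of `x₀`.
  have key : ∀ (p q : 𝒢.VertexOrbits X) (a : 𝒢.FundamentalGroup T), a • q.2.out = p.2.out →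
      d p.1 p.2.out * c a q.2.out * (d q.1 q.2.out)⁻¹ ∈ L := by
    intro p q a ha
    have h1 : (g p)⁻¹ * a * g q ∈ stabilizer (𝒢.FundamentalGroup T) x₀ := by
      rw [mem_stabilizer_iff, mul_smul, mul_smul, hg, ha, inv_smul_eq_iff, hg]
    have h2 : c (a * g q) x₀ = c a q.2.out * c (g q) x₀ := by rw [hc, hg]
    have h3 : c (a * g q) x₀ = c (g p) x₀ * c ((g p)⁻¹ * a * g q) x₀ := by
      have := hc (g p) ((g p)⁻¹ * a * g q) x₀
      rwa [mem_stabilizer_iff.1 h1, ← mul_assoc, mul_inv_cancel_left] at this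
    convert mul_mem (mul_mem (hδ₀ p) (hstab₀ ⟨_, h1⟩)) (inv_mem (hδ₀ q)) using 1
    rw [eq_mul_inv_of_mul_eq (h2.symm.trans h3)]
    simp only [δ]
    group
  have hbase : ∀ u x, d u x = d u (orbitClass (𝒢.vertexGroup u) x).out *
      (c (𝒢.ofVertex T u (r u x)) (orbitClass (𝒢.vertexGroup u) x).out)⁻¹ := by
    intro u x
    rw [hcV, hγr, hr]
    group
  have hA : ∀ (p : 𝒢.VertexOrbits X) (a : 𝒢.OrbitStabilizer X p), Coprod.inl (CoprodI.of a) ∈ L := by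
    intro p a
    have h1 := hγA p.1 p.2 a
    have h2 := key p p (𝒢.ofVertex T p.1 a) ((hvs _ _ _).trans a.2)
    rw [hcV, h1, mem_stabilizer_iff.1 a.2] at h2
    convert h2 using 1
    simp only [MonoidHom.comp_apply]
    group
  have hE : ∀ m : 𝒢.EdgeOrbits X, Coprod.inr (FreeGroup.of m) ∈ L := by
    rintro ⟨e, o⟩
    have h1 := hcE e o.out
    have hz := hr (𝒢.origin e) (𝒢.ofEdge T e • o.out)
    have hy := hr (𝒢.terminus e) o.out
    set z := 𝒢.ofEdge T e • o.out
    have h2 := hc.inv (𝒢.ofVertex T _ (r (𝒢.origin e) z))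
      (orbitClass (𝒢.vertexGroup (𝒢.origin e)) z).out
    rw [hvs, hz] at h2
    -- This path runs from base point to base point through the stable letter. By `hbase` the
    -- transporters at both ends cancel, leaving the free generator of the edge orbit.
    have h3 := key (𝒢.vertexOrbit (𝒢.origin e) z) (𝒢.vertexOrbit (𝒢.terminus e) o.out)
      ((𝒢.ofVertex T _ (r (𝒢.origin e) z))⁻¹ * 𝒢.ofEdge T e *
        𝒢.ofVertex T _ (r (𝒢.terminus e) o.out)) (by
          rw [mul_smul, mul_smul, hvs, hy, inv_smul_eq_iff, hvs, hz])
    rw [hc, hc, hvs, hy, h2, h1, hbase (𝒢.origin e) z, hbase (𝒢.terminus e) o.out, hτs] at h3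
    convert h3 using 1
    group
  rw [Subgroup.eq_top_iff']
  intro q
  induction q using Coprod.induction_on with
  | inl x =>
    induction x using CoprodI.induction_on with
    | one => rw [map_one]; exact one_mem _
    | of p a => exact hA p a
    | mul x y hx hy => rw [map_mul]; exact mul_mem hx hy
  | inr x =>
    induction x using FreeGroup.induction_on with
    | C1 => rw [map_one]; exact one_mem _
    | of m => exact hE m
    | inv_of m h => rw [map_inv]; exact inv_mem h
    | mul x y hx hy => rw [map_mul]; exact mul_mem hx hy
  | mul x y hx hy => exact mul_mem hx hy

end GraphOfGroups

/-! ### General properties of the rank gradient. -/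

section RankGradient

variable {G : Type*} [Group G] [Group.FG G]

theorem rankGradient_le (H : Subgroup G) [hH : H.FiniteIndex] :
    rankGradient G ≤ ((Group.rank H : ℝ) - 1) / (H.index : ℝ) := by
  refine ciInf_le (f := fun H : {H : Subgroup G // H.FiniteIndex} =>
    haveI := H.2
    ((Group.rank (H : Subgroup G) : ℝ) - 1) / ((H : Subgroup G).index : ℝ)) ⟨-1, ?_⟩ ⟨H, hH⟩
  rintro _ ⟨⟨K, hK⟩, rfl⟩
  have h1 : (1 : ℝ) ≤ (K.index : ℝ) := by
    exact_mod_cast Nat.one_le_iff_ne_zero.2 hK.index_ne_zero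
  have h2 : (0 : ℝ) ≤ (Group.rank K : ℝ) := Nat.cast_nonneg _
  change -1 ≤ ((Group.rank K : ℝ) - 1) / (K.index : ℝ)
  rw [le_div_iff₀ (by linarith)]
  linarith

theorem le_rankGradient {b : ℝ} (h : ∀ (H : Subgroup G) [H.FiniteIndex],
    b ≤ ((Group.rank H : ℝ) - 1) / (H.index : ℝ)) : b ≤ rankGradient G :=
  haveI : Nonempty {H : Subgroup G // H.FiniteIndex} := ⟨⟨⊤, inferInstance⟩⟩
  le_ciInf fun ⟨H, _⟩ => h H

/-- Schreier's inequality for `K` in `H`, divided by `[G : K] = [H : K] [G : H]`. Hence only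
arbitrarily small subgroups of finite index matter for the infimum. -/
theorem rank_sub_one_div_index_le {K H : Subgroup G} [K.FiniteIndex] [H.FiniteIndex] (hKH : K ≤ H) :
    ((Group.rank K : ℝ) - 1) / (K.index : ℝ) ≤ ((Group.rank H : ℝ) - 1) / (H.index : ℝ) := by
  have h1 := (K.subgroupOf H).rank_add_index_le
  rw [Group.rank_congr (Subgroup.subgroupOfEquivOfLe hKH)] at h1
  have h2 : (K.subgroupOf H).index * H.index = K.index := Subgroup.relIndex_mul_index hKH
  have h3 : (0 : ℝ) < (H.index : ℝ) := by
    exact_mod_cast Nat.pos_of_ne_zero Subgroup.FiniteIndex.index_ne_zero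
  have h4 : (0 : ℝ) < ((K.subgroupOf H).index : ℝ) := by
    exact_mod_cast Nat.pos_of_ne_zero Subgroup.FiniteIndex.index_ne_zero
  have h5 : (Group.rank K : ℝ) + ((K.subgroupOf H).index : ℝ) ≤
      ((K.subgroupOf H).index : ℝ) * (Group.rank H : ℝ) + 1 := by exact_mod_cast h1
  rw [← h2, Nat.cast_mul, div_le_div_iff₀ (mul_pos h4 h3) h3]
  nlinarith

/-- By monotonicity a nearly optimal subgroup may be replaced by the normal core of its intersection
with `N`. -/
theorem exists_normal_lt_rankGradient_add (N : Subgroup G) [N.FiniteIndex] {ε : ℝ} (hε : 0 < ε) :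
    ∃ (K : Subgroup G) (_ : K.FiniteIndex), K.Normal ∧ K ≤ N ∧
      ((Group.rank K : ℝ) - 1) / (K.index : ℝ) < rankGradient G + ε := by
  have : Nonempty {H : Subgroup G // H.FiniteIndex} := ⟨⟨⊤, inferInstance⟩⟩
  obtain ⟨⟨H, hH⟩, h⟩ := exists_lt_of_ciInf_lt (lt_add_of_pos_right (rankGradient G) hε)
  refine ⟨(H ⊓ N).normalCore, inferInstance, inferInstance,
    (Subgroup.normalCore_le _).trans inf_le_right, lt_of_le_of_lt ?_ h⟩
  exact rank_sub_one_div_index_le ((Subgroup.normalCore_le _).trans inf_le_left)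

/-- In a group that is residually finite or virtually torsion free, finitely many elements of finite
order can be avoided by a normal subgroup of finite index. -/
theorem exists_normal_finiteIndex_of_finite {G : Type*} [Group G]
    (hG : Group.ResiduallyFinite G ∨ IsVirtuallyTorsionFree G) {F : Set G} (hF : F.Finite)
    (hF' : ∀ g ∈ F, IsOfFinOrder g) :
    ∃ N : Subgroup G, N.Normal ∧ N.FiniteIndex ∧ ∀ g ∈ F, g ∈ N → g = 1 := by
  suffices h : ∃ N : Subgroup G, N.FiniteIndex ∧ ∀ g ∈ F, g ∈ N → g = 1 by
    obtain ⟨N, hN, hNF⟩ := h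
    exact ⟨N.normalCore, inferInstance, inferInstance, fun g hg hgN =>
      hNF g hg (N.normalCore_le hgN)⟩
  rcases hG with hG | ⟨H, hH, htf⟩
  · have h1 : ∀ g : G, ∃ H : Subgroup G, H.FiniteIndex ∧ (g ∈ H → g = 1) := by
      intro g
      by_cases hg : g = 1
      · exact ⟨⊤, inferInstance, fun _ => hg⟩
      · obtain ⟨H, hH, hgH⟩ := Group.residuallyFinite_iff_exists_finiteIndex.1 hG g hg
        exact ⟨H, hH, fun h => (hgH h).elim⟩
    choose H hH hgH using h1
    have : Finite F := hF
    refine ⟨⨅ g : F, H g, Subgroup.finiteIndex_iInf fun g => hH g, fun g hg hgN => ?_⟩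
    exact hgH g (Subgroup.mem_iInf.1 hgN ⟨g, hg⟩)
  · exact ⟨H, hH, fun g hg hgH => htf g hgH (hF' g hg)⟩

end RankGradient

/-! ### The rank formula in the fundamental group and the conclusion. -/

namespace GraphOfGroups

open MulAction

variable {V E : Type*} {𝒢 : GraphOfGroups V E} {T : Set E}

/-- The vertex groups have normal subgroups of finite index that meet the edge groups trivially. -/
theorem exists_vertex_normal_finiteIndex [Finite E] [∀ e, Finite (𝒢.edgeGroup e)]
    (h𝒢 : ∀ u, Group.ResiduallyFinite (𝒢.vertexGroup u) ∨
      IsVirtuallyTorsionFree (𝒢.vertexGroup u)) :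
    ∃ N : ∀ u, Subgroup (𝒢.vertexGroup u), (∀ u, (N u).Normal) ∧ (∀ u, (N u).FiniteIndex) ∧
      (∀ e a, 𝒢.toOrigin e a ∈ N _ → a = 1) ∧ ∀ e a, 𝒢.toTerminus e a ∈ N _ → a = 1 := by
  let F : Set (Σ u, 𝒢.vertexGroup u) :=
    Set.range (fun x : Σ e, 𝒢.edgeGroup e => ⟨_, 𝒢.toOrigin x.1 x.2⟩) ∪
      Set.range fun x : Σ e, 𝒢.edgeGroup e => ⟨_, 𝒢.toTerminus x.1 x.2⟩
  have hF : F.Finite := (Set.finite_range _).union (Set.finite_range _)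
  have hord : ∀ x ∈ F, IsOfFinOrder x.2 := by
    rintro _ (⟨x, rfl⟩ | ⟨x, rfl⟩)
    · exact MonoidHom.isOfFinOrder _ (isOfFinOrder_of_finite x.2)
    · exact MonoidHom.isOfFinOrder _ (isOfFinOrder_of_finite x.2)
  choose N hN hN' hNF using fun u => exists_normal_finiteIndex_of_finite (h𝒢 u)
    (hF.preimage (f := Sigma.mk u) sigma_mk_injective.injOn) fun g hg => hord ⟨u, g⟩ hg
  refine ⟨N, hN, hN', fun e a h => ?_, fun e a h => ?_⟩
  · exact (map_eq_one_iff _ (𝒢.toOrigin_injective e)).1 (hNF _ _ (Or.inl ⟨⟨e, a⟩, rfl⟩) h)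
  · exact (map_eq_one_iff _ (𝒢.toTerminus_injective e)).1 (hNF _ _ (Or.inr ⟨⟨e, a⟩, rfl⟩) h)

/-- The number of generators of a point stabilizer of the fundamental group, if the edge groups act
freely. -/
theorem IsMaximalTree.rank_stabilizer_sub_one [Fintype V] [Fintype E]
    (hT : 𝒢.IsMaximalTree T) {X : Type*} [Finite X] [MulAction (𝒢.FundamentalGroup T) X]
    [IsPretransitive (𝒢.FundamentalGroup T) X]
    [∀ u, MulAction (𝒢.vertexGroup u) X] [∀ e, MulAction (𝒢.edgeGroup e) X]
    [∀ u, Fintype (orbitRel.Quotient (𝒢.vertexGroup u) X)] [∀ e, Finite (𝒢.edgeGroup e)]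
    (h : (𝒢.marking T).IsCompatible X)
    (hfree : ∀ e (a : 𝒢.edgeGroup e) (x : X), a • x = x → a = 1) (x₀ : X)
    [Group.FG (stabilizer (𝒢.FundamentalGroup T) x₀)]
    [∀ (u : V) (x : X), Group.FG (stabilizer (𝒢.vertexGroup u) x)] :
    (Group.rank (stabilizer (𝒢.FundamentalGroup T) x₀) : ℝ) - 1 =
      ∑ u, ∑ o : orbitRel.Quotient (𝒢.vertexGroup u) X,
        ((Group.rank (stabilizer (𝒢.vertexGroup u) o.out) : ℝ) - 1) +
      ∑ e, (Nat.card X : ℝ) / (Nat.card (𝒢.edgeGroup e) : ℝ) := by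
  have h1 := h.rank_stabilizer_add_card_le hT x₀
  have h2 := hT.card_le_rank_stabilizer_add_card h hfree x₀
  have h3 := le_antisymm h1 h2
  have h4 : (Nat.card (𝒢.EdgeOrbits X) : ℝ) =
      ∑ e, (Nat.card X : ℝ) / (Nat.card (𝒢.edgeGroup e) : ℝ) := by
    rw [Nat.card_sigma, Nat.cast_sum]
    refine Finset.sum_congr rfl fun e _ => ?_
    rw [← card_orbits_mul_card (hfree e), Nat.cast_mul, mul_div_cancel_right₀]
    exact_mod_cast Nat.card_pos.ne'
  rw [← h4]
  simp only [Finset.sum_sub_distrib, ← Nat.cast_sum, Finset.sum_const, Finset.card_univ,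
    nsmul_eq_mul, mul_one]
  rw [← Fintype.sum_sigma' (f := fun u (o : orbitRel.Quotient (𝒢.vertexGroup u) X) =>
    Group.rank (stabilizer (𝒢.vertexGroup u) o.out)), ← Fintype.card_sigma,
    ← Nat.card_eq_fintype_card]
  have h5 : (Group.rank (stabilizer (𝒢.FundamentalGroup T) x₀) : ℝ) +
      (Nat.card (𝒢.VertexOrbits X) : ℝ) =
      ((∑ p : 𝒢.VertexOrbits X, Group.rank (stabilizer (𝒢.vertexGroup p.1) p.2.out) : ℕ) : ℝ) +
        (Nat.card (𝒢.EdgeOrbits X) : ℝ) + 1 := by exact_mod_cast h3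
  linarith

/-- The normalized number of generators of a subgroup of finite index in the fundamental group whose
conjugates meet the edge groups trivially: the contribution of a vertex is an average over the
preimages in the vertex group of the conjugates of the subgroup. -/
theorem IsMaximalTree.exists_rank_sub_one_div_index_eq [Fintype V] [Fintype E]
    (hT : 𝒢.IsMaximalTree T) [∀ u, Group.FG (𝒢.vertexGroup u)] [∀ e, Finite (𝒢.edgeGroup e)]
    (H : Subgroup (𝒢.FundamentalGroup T)) [H.FiniteIndex]
    (hfree : ∀ e a g, g⁻¹ * 𝒢.ofVertex T _ (𝒢.toTerminus e a) * g ∈ H → a = 1) :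
    ∃ m : V → ℝ, ((Group.rank H : ℝ) - 1) / (H.index : ℝ) =
        ∑ u, m u + ∑ e, 1 / (Nat.card (𝒢.edgeGroup e) : ℝ) ∧
      (∀ u, rankGradient (𝒢.vertexGroup u) ≤ m u) ∧
      ∀ u b, (∀ (K : Subgroup (𝒢.vertexGroup u)) [K.FiniteIndex],
        (∃ g, ∀ a, a ∈ K ↔ g⁻¹ * 𝒢.ofVertex T u a * g ∈ H) →
          ((Group.rank K : ℝ) - 1) / (K.index : ℝ) ≤ b) → m u ≤ b := by
  let X := 𝒢.FundamentalGroup T ⧸ H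
  let _ : ∀ u, MulAction (𝒢.vertexGroup u) X := fun u => MulAction.compHom X (𝒢.ofVertex T u)
  let _ : ∀ e, MulAction (𝒢.edgeGroup e) X := fun e =>
    MulAction.compHom X ((𝒢.ofVertex T _).comp (𝒢.toTerminus e))
  have hX : (𝒢.marking T).IsCompatible X := ⟨fun _ _ _ => rfl, fun _ _ _ => rfl⟩
  have : Finite X := inferInstance
  let _ : ∀ u, Fintype (orbitRel.Quotient (𝒢.vertexGroup u) X) := fun u => Fintype.ofFinite _
  have hfix : ∀ u (a : 𝒢.vertexGroup u) (g : 𝒢.FundamentalGroup T),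
      a • (g : X) = (g : X) ↔ g⁻¹ * 𝒢.ofVertex T u a * g ∈ H := by
    intro u a g
    rw [eq_comm, mul_assoc]
    exact QuotientGroup.eq
  have hfree' : ∀ e (a : 𝒢.edgeGroup e) (x : X), a • x = x → a = 1 := by
    intro e a x hx
    obtain ⟨g, rfl⟩ := QuotientGroup.mk_surjective x
    exact hfree e a g ((hfix _ _ g).1 hx)
  have hfi : ∀ u (x : X), (stabilizer (𝒢.vertexGroup u) x).FiniteIndex := by
    intro u x
    refine ⟨?_⟩
    rw [index_stabilizer]
    exact ((Set.ncard_pos (Set.toFinite _)).2 ⟨x, mem_orbit_self x⟩).ne'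
  have hstab : stabilizer (𝒢.FundamentalGroup T) ((1 : 𝒢.FundamentalGroup T) : X) = H :=
    stabilizer_quotient H
  have : Group.FG (stabilizer (𝒢.FundamentalGroup T) ((1 : 𝒢.FundamentalGroup T) : X)) :=
    hstab.symm ▸ inferInstance
  have hmain := hT.rank_stabilizer_sub_one hX hfree' ((1 : 𝒢.FundamentalGroup T) : X)
  rw [Subgroup.rank_congr hstab] at hmain
  have hcard : (0 : ℝ) < (Nat.card X : ℝ) := by exact_mod_cast Nat.card_pos
  have hsum : ∀ u, (Nat.card X : ℝ) =
      ∑ o : orbitRel.Quotient (𝒢.vertexGroup u) X, ((stabilizer (𝒢.vertexGroup u) o.out).index : ℝ) := by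
    intro u
    rw [← sum_index_stabilizer_out (𝒢.vertexGroup u) X, Nat.cast_sum]
  have hpos : ∀ u (x : X), (0 : ℝ) < ((stabilizer (𝒢.vertexGroup u) x).index : ℝ) := fun u x => by
    exact_mod_cast Nat.pos_of_ne_zero (hfi u x).index_ne_zero
  -- By `hsum` the weights `index / |X|` of the orbits add up to one, so this is a weighted mean of
  -- the ratios of the stabilizers.
  refine ⟨fun u => (∑ o : orbitRel.Quotient (𝒢.vertexGroup u) X,
    ((Group.rank (stabilizer (𝒢.vertexGroup u) o.out) : ℝ) - 1)) / (Nat.card X : ℝ), ?_, ?_, ?_⟩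
  · rw [show H.index = Nat.card X from rfl, hmain, add_div, Finset.sum_div, Finset.sum_div]
    congr 1
    refine Finset.sum_congr rfl fun e _ => ?_
    field_simp
  · intro u
    rw [le_div_iff₀ hcard, hsum u, Finset.mul_sum]
    exact Finset.sum_le_sum fun o _ => (le_div_iff₀ (hpos u _)).1 (rankGradient_le _)
  · intro u b hb
    rw [div_le_iff₀ hcard, hsum u, Finset.mul_sum]
    refine Finset.sum_le_sum fun o _ => (div_le_iff₀ (hpos u _)).1 (hb _ ?_)
    obtain ⟨g, hg⟩ := QuotientGroup.mk_surjective o.out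
    exact ⟨g, fun a => by rw [← hfix, mem_stabilizer_iff, hg]⟩

end GraphOfGroups

theorem corollary3p8 {V E : Type*} [Fintype V] [Fintype E] (𝒢 : GraphOfGroups V E)
    (T : Set E) (hT : 𝒢.IsMaximalTree T)
    [∀ u, Group.FG (𝒢.vertexGroup u)] [∀ e, Finite (𝒢.edgeGroup e)]
    (h𝒢 : ∀ u, Group.ResiduallyFinite (𝒢.vertexGroup u) ∨
      IsVirtuallyTorsionFree (𝒢.vertexGroup u)) :
    rankGradient (𝒢.FundamentalGroup T) =
      ∑ u, rankGradient (𝒢.vertexGroup u) + ∑ e, 1 / (Nat.card (𝒢.edgeGroup e) : ℝ) := by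
  obtain ⟨N, hN, hN', hNo, hNt⟩ := GraphOfGroups.exists_vertex_normal_finiteIndex h𝒢
  have hnf : ∀ (H : Subgroup (𝒢.FundamentalGroup T)), H.Normal →
      (∀ u, H.comap (𝒢.ofVertex T u) ≤ N u) →
      ∀ e a g, g⁻¹ * 𝒢.ofVertex T _ (𝒢.toTerminus e a) * g ∈ H → a = 1 := by
    intro H hH hHN e a g h
    refine hNt e a (hHN _ ?_)
    have := hH.conj_mem _ h g
    rw [Subgroup.mem_comap]
    convert this using 1
    group
  refine le_antisymm (le_of_forall_pos_le_add fun ε hε => ?_)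
    (le_rankGradient ?_)
  · have hε' : 0 < ε / (Fintype.card V + 1) := by positivity
    choose K hK hKn hKN hKε using fun u => exists_normal_lt_rankGradient_add (N u) hε'
    obtain ⟨H, hH, hH', hHK⟩ := hT.exists_normal_finiteIndex K
      (fun e a h => hNo e a (hKN _ h)) fun e a h => hNt e a (hKN _ h)
    obtain ⟨m, hm, -, hm'⟩ := hT.exists_rank_sub_one_div_index_eq H
      (hnf H hH fun u => (hHK u).trans_le (hKN u))
    have hmu : ∀ u, m u ≤ rankGradient (𝒢.vertexGroup u) + ε / (Fintype.card V + 1) := by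
      intro u
      refine hm' u _ fun L _ ⟨g, hg⟩ => ?_
      -- As `H` is normal, all its conjugates have the same preimage, so the mean at `u` is taken
      -- over a single subgroup.
      have hL : L = K u := by
        ext a
        rw [hg, ← hHK u, Subgroup.mem_comap, hH.mem_comm_iff, mul_inv_cancel_left]
      subst hL
      exact (hKε u).le
    have hsum := Finset.sum_le_sum fun u (_ : u ∈ Finset.univ) => hmu u
    rw [Finset.sum_add_distrib, Finset.sum_const, Finset.card_univ, nsmul_eq_mul] at hsum
    have hle : (Fintype.card V : ℝ) * (ε / (Fintype.card V + 1)) ≤ ε := by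
      rw [mul_div_assoc', div_le_iff₀ (by positivity)]
      nlinarith
    have := rankGradient_le H
    linarith
  · intro H _
    -- An arbitrary `H` may meet the edge groups; `H ⊓ M` has only trivial intersections with their
    -- conjugates, and its ratio is no larger.
    obtain ⟨M, hM, hM', hMN⟩ := hT.exists_normal_finiteIndex N hNo hNt
    obtain ⟨m, hm, hm', -⟩ := hT.exists_rank_sub_one_div_index_eq (H ⊓ M)
      fun e a g h => hnf M hM (fun u => (hMN u).le) e a g h.2
    refine le_trans ?_ (rank_sub_one_div_index_le (inf_le_left : H ⊓ M ≤ H))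
    rw [hm]
    have hsum := Finset.sum_le_sum fun u (_ : u ∈ Finset.univ) => hm' u
    linarith
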